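/- **Setting.** Let $H$ be a separable real Hilbert space, $T\in(0,\infty)$, let $(\Omega,\mathcal F,\mathbb P)$ be a probability space with a normal filtration $(\mathbb F_t)_{t\in[0,T]}$ (right-continuous and containing all $\mathbb P$-null events), and let $(W_t)_{t\in[0,T]}$ be an $\mathrm{id}_H$-cylindrical $(\mathbb F_t)$-Wiener process. Let $\mathbb H\subseteq H$ be a non-empty orthonormal basis of $H$, let $\lambda\colon\mathbb H\to\mathbb R$ satisfy $\sup_{h\in\mathbb H}\lambda_h<0$, and let $A$ be the diagonal operator $Av=\sum_{h\in\mathbb H}\lambda_h\langle h,v\rangle_H h$ with domain $D(A)=\{v\in H\colon\sum_{h\in\mathbb H}|\lambda_h\langle h,v\rangle_H|^2<\infty\}$. Let $(H_r)_{r\in\mathbb R}$ be the interpolation spaces associated to $-A$ (so $\|v\|_{H_r}=\|(-A)^rv\|_H$, with $H_r=D((-A)^r)$ for $r\ge0$ and $H_r$ the completion of $H$ in this norm for $r<0$), and let $\mathbf H_r=H_{r/2}\times H_{r/2-1/2}$, $r\in\mathbb R$, with the product Hilbert space structure. For $I\subseteq\mathbb H$ let $P_I$ be given on every $H_r$ by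 $P_I(u)=\sum_{h\in I}\langle|\lambda_h|^{-r}h,u\rangle_{H_r}|\lambda_h|^{-r}h$, and let $\mathbf P_I(v,w)=(P_I(v),P_I(w))$. Let $\mathbf A\colon D(\mathbf A)\subseteq\mathbf H_0\to\mathbf H_0$ be the operator with $D(\mathbf A)=\mathbf H_1$ and $\mathbf A(v,w)=(w,Av)$ (with $A$ extended to $H_{1/2}\to H_{-1/2}$), and let $(\mathrm e^{t\mathbf A})_{t\ge0}$ be the strongly continuous semigroup that it generates. Let $\mu\colon\mathbb H\to\mathbb R$ satisfy $\sum_{h\in\mathbb H}|\mu_h|^2/|\lambda_h|<\infty$, and let $\mathbf B\in\mathrm{HS}(H,\mathbf H_0)$ be given by $\mathbf Bv=\bigl(0,\sum_{h\in\mathbb H}\mu_h\langle h,v\rangle_H h\bigr)$. For every $I\subseteq\mathbb H$ let $\mathbf X^I=(X^{I,1},X^{I,2})\colon\Omega\to\mathbf P_I(\mathbf H_0)$ be a random variable such that, $\mathbb P$-a.s., $$\mathbf X^I=\int_0^T\mathrm e^{(T-s)\mathbf A}\,\mathbf P_I\mathbf B\,\mathrm dW_s .$$ **Proposition.** For $i\in\{1,2\}$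 let $\varphi_i\colon\mathbf H_0\to\mathbb R$ be given by $\varphi_i(v_1,v_2)=\exp\bigl(-\|v_i\|^2_{H_{1/2-i/2}}\bigr)$. Then for all $i\in\{1,2\}$ and all $I\subseteq\mathbb H$ it holds that $\varphi_i\in C^2_{\mathrm b}(\mathbf H_0,\mathbb R)$, that is, $\varphi_i$ is bounded and twice continuously Fréchet differentiable with bounded first and second derivatives, and $$\mathbb E[\varphi_i(\mathbf X^I)]-\mathbb E[\varphi_i(\mathbf X^{\mathbb H})]\;\ge\;\frac{\mathbb E\bigl[\|X^{\mathbb H,i}\|^2_{H_{1/2-i/2}}\bigr]-\mathbb E\bigl[\|X^{I,i}\|^2_{H_{1/2-i/2}}\bigr]}{\exp\bigl(6\,\mathbb E\bigl[\|X^{\mathbb H,i}\|^2_{H_{1/2-i/2}}\bigr]\bigr)} ,$$ where all expectations are finite. -/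

import Mathlib

open MeasureTheory ProbabilityTheory Filter Topology
open scoped ENNReal NNReal

noncomputable section

/-! ### The interpolation spaces of a diagonal operator -/

/-- `sup_h λ_h < 0`. -/
def SupNeg {ι : Type*} (lam : ι → ℝ) : Prop := ∃ c : ℝ, c < 0 ∧ ∀ i, lam i ≤ c

theorem SupNeg.neg {ι : Type*} {lam : ι → ℝ} (h : SupNeg lam) {i : ι} : lam i < 0 := by
  obtain ⟨c, hc, h⟩ := h
  exact (h i).trans_lt hc

/-- Formal series `∑ u_h h`, i.e. coefficient families `u`, with
`∑ (|λ_h| ^ r * u_h) ^ 2 < ∞`. -/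
def interpSubmodule {ι : Type*} (lam : ι → ℝ) (r : ℝ) : Submodule ℝ (ι → ℝ) where
  carrier := {u | Summable fun i => (|lam i| ^ r * u i) ^ 2}
  zero_mem' := by simp [summable_zero]
  add_mem' := by
    intro u v hu hv
    refine Summable.of_nonneg_of_le (fun i => sq_nonneg _) (fun i => ?_)
      ((hu.mul_left 2).add (hv.mul_left 2))
    simp only [Pi.add_apply]
    nlinarith [sq_nonneg (|lam i| ^ r * u i - |lam i| ^ r * v i)]
  smul_mem' := by
    intro c u hu
    refine (hu.mul_left (c ^ 2)).congr (fun i => ?_)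
    simp only [Pi.smul_apply, smul_eq_mul]
    ring

/-- The interpolation space `H_r` associated to `-A`, where `A` is the diagonal operator with
eigenvalues `λ_h` with respect to an orthonormal basis `(h)` of `H`. An element is given by its
family of (formal) coefficients with respect to the basis, `v ∈ H` being identified with
`(⟨h, v⟩_H)_h`. Thus `H_0 = H`, for `r ≥ 0` the space `H_r` is the domain of `(-A) ^ r` with
norm `‖(-A) ^ r v‖_H`, and for `r < 0` it is the completion of `H` for that norm. -/
def InterpSpace {ι : Type*} (lam : ι → ℝ) (r : ℝ) : Type _ := ↥(interpSubmodule lam r)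

namespace InterpSpace

variable {ι : Type*} {lam : ι → ℝ} {r : ℝ}

instance : AddCommGroup (InterpSpace lam r) :=
  inferInstanceAs (AddCommGroup ↥(interpSubmodule lam r))

instance : Module ℝ (InterpSpace lam r) :=
  inferInstanceAs (Module ℝ ↥(interpSubmodule lam r))

/-- The family of coefficients with respect to the basis `(h)` of `H`. -/
def coeff : InterpSpace lam r →ₗ[ℝ] (ι → ℝ) := (interpSubmodule lam r).subtype

/-- The element with given coefficients. -/
def mk (u : ι → ℝ) (hu : Summable fun i => (|lam i| ^ r * u i) ^ 2) : InterpSpace lam r := ⟨u, hu⟩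

@[simp] theorem coeff_mk (u : ι → ℝ) (hu : Summable fun i => (|lam i| ^ r * u i) ^ 2) :
    coeff (mk (r := r) u hu) = u := rfl

theorem coeff_injective : Function.Injective (coeff : InterpSpace lam r →ₗ[ℝ] (ι → ℝ)) :=
  Subtype.val_injective

theorem summable (u : InterpSpace lam r) : Summable fun i => (|lam i| ^ r * coeff u i) ^ 2 := u.2

/-- The map `∑ u_h h ↦ ∑ |λ_h| ^ r u_h h`, that is `(-A) ^ r : H_r → H`, with values in `ℓ²`. -/
def toL2 : InterpSpace lam r →ₗ[ℝ] lp (fun _ : ι => ℝ) 2 where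
  toFun u := ⟨fun i => |lam i| ^ r * coeff u i, memℓp_gen (by
    simpa only [ENNReal.toReal_ofNat, Real.rpow_two, Real.norm_eq_abs, sq_abs] using u.summable)⟩
  map_add' u v := by ext i; exact mul_add _ _ _
  map_smul' c u := by ext i; exact mul_left_comm _ _ _

@[simp] theorem toL2_apply (u : InterpSpace lam r) (i : ι) :
    toL2 u i = |lam i| ^ r * coeff u i := rfl

variable [Fact (SupNeg lam)]

theorem toL2_injective : Function.Injective (toL2 : InterpSpace lam r →ₗ[ℝ] _) := by
  intro u v h
  apply coeff_injective
  funext i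
  have h1 : toL2 u i = toL2 v i := by rw [h]
  have h2 : |lam i| ^ r ≠ 0 :=
    (Real.rpow_pos_of_pos (abs_pos.2 (Fact.out (p := SupNeg lam)).neg.ne) r).ne'
  simpa [h2] using h1

instance : NormedAddCommGroup (InterpSpace lam r) :=
  NormedAddCommGroup.induced _ _ toL2 toL2_injective

instance : InnerProductSpace ℝ (InterpSpace lam r) where
  __ := NormedSpace.induced ℝ (InterpSpace lam r) _ toL2
  inner u v := inner ℝ (toL2 u) (toL2 v)
  norm_sq_eq_re_inner u := norm_sq_eq_re_inner (𝕜 := ℝ) (toL2 u)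
  conj_inner_symm u v := inner_conj_symm (toL2 u) (toL2 v)
  add_left u v w := by rw [map_add, inner_add_left]
  smul_left u v c := by rw [map_smul, inner_smul_left]

theorem norm_sq_eq_tsum (u : InterpSpace lam r) :
    ‖u‖ ^ 2 = ∑' i, (|lam i| ^ r * coeff u i) ^ 2 := by
  have h : ‖u‖ ^ 2 = inner ℝ (toL2 u) (toL2 u) := norm_sq_eq_re_inner (𝕜 := ℝ) (toL2 u)
  rw [h, lp.inner_eq_tsum]
  exact tsum_congr fun i => (sq _).symm

/-- `(-A) ^ r : H_r → H` is an isometric isomorphism. -/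
def toL2Equiv : InterpSpace lam r ≃ₗᵢ[ℝ] lp (fun _ : ι => ℝ) 2 where
  toLinearEquiv := LinearEquiv.ofBijective toL2 ⟨toL2_injective, fun f => by
    have h2 : ∀ i, |lam i| ^ r ≠ 0 := fun i =>
      (Real.rpow_pos_of_pos (abs_pos.2 (Fact.out (p := SupNeg lam)).neg.ne) r).ne'
    have h3 : ∀ i, |lam i| ^ r * ((|lam i| ^ r)⁻¹ * f i) = f i := fun i =>
      mul_inv_cancel_left₀ (h2 i) _
    refine ⟨mk (fun i => (|lam i| ^ r)⁻¹ * f i) ?_, ?_⟩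
    · simp only [h3]
      simpa using (lp.memℓp f).summable (by norm_num)
    · ext i
      simp [h3]⟩
  norm_map' _ := rfl

instance : CompleteSpace (InterpSpace lam r) :=
  (completeSpace_congr (e := toL2Equiv.toLinearEquiv.toEquiv)
    toL2Equiv.isometry.isUniformEmbedding).2 inferInstance

/-- The projection `P_I` on `H_r`: it keeps the terms of the expansion with index in `I`. -/
def proj (I : Set ι) : InterpSpace lam r →L[ℝ] InterpSpace lam r :=
  LinearMap.mkContinuous
    { toFun := fun u => mk (I.indicator (coeff u))
        (Summable.of_nonneg_of_le (fun _ => sq_nonneg _) (fun i => by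
          by_cases hi : i ∈ I <;> simp [hi, sq_nonneg]) u.summable)
      map_add' := fun u v => coeff_injective (by
        funext i; by_cases hi : i ∈ I <;> simp [hi])
      map_smul' := fun c u => coeff_injective (by
        funext i; by_cases hi : i ∈ I <;> simp [hi]) } 1 (fun u => by
    rw [one_mul]
    refine le_of_sq_le_sq ?_ (norm_nonneg _)
    rw [norm_sq_eq_tsum, norm_sq_eq_tsum]
    refine Summable.tsum_le_tsum (fun i => ?_) (summable _) u.summable
    by_cases hi : i ∈ I <;> simp [hi, sq_nonneg])

end InterpSpace

/-! ### The phase space, the projections and the wave operator -/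

/-- The Hilbert space `𝐇_r = H_{r/2} × H_{r/2-1/2}` with the product inner product. -/
abbrev PhaseSpace {ι : Type*} (lam : ι → ℝ) (r : ℝ) : Type _ :=
  WithLp 2 (InterpSpace lam (r / 2) × InterpSpace lam (r / 2 - 1 / 2))

section Wave

open InterpSpace

variable {ι : Type*} (lam : ι → ℝ) [Fact (SupNeg lam)]

/-- The projection `𝐏_I (v, w) = (P_I v, P_I w)`. -/
def phaseProj (r : ℝ) (I : Set ι) : PhaseSpace lam r →L[ℝ] PhaseSpace lam r :=
  (WithLp.prodContinuousLinearEquiv 2 ℝ _ _).symm.toContinuousLinearMap ∘L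
    ((proj I).prodMap (proj I)) ∘L
      (WithLp.prodContinuousLinearEquiv 2 ℝ _ _).toContinuousLinearMap

/-- The wave operator `𝐀 (v, w) = (w, A v)` on `𝐇_0` with domain `D(𝐀) = 𝐇_1 = H_{1/2} × H_0`;
here `A` acts by `h ↦ λ_h h`. -/
def waveOp : PhaseSpace lam 0 →ₗ.[ℝ] PhaseSpace lam 0 where
  domain :=
    { carrier := {x | coeff x.fst ∈ interpSubmodule lam (1 / 2) ∧
        coeff x.snd ∈ interpSubmodule lam (1 / 2 - 1 / 2)}
      zero_mem' := by simp
      add_mem' := fun hx hy => by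
        simp only [Set.mem_ofPred_eq, WithLp.add_fst, WithLp.add_snd, map_add] at *
        exact ⟨add_mem hx.1 hy.1, add_mem hx.2 hy.2⟩
      smul_mem' := fun c x hx => by
        simp only [Set.mem_ofPred_eq, WithLp.smul_fst, WithLp.smul_snd, map_smul] at *
        exact ⟨Submodule.smul_mem _ c hx.1, Submodule.smul_mem _ c hx.2⟩ }
  toFun :=
    { toFun := fun x => WithLp.toLp 2
        (mk (coeff x.1.snd) (by
          have h : Summable _ := x.2.2
          simpa using h),
         mk (fun i => lam i * coeff x.1.fst i) (by
          have h : Summable _ := x.2.1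
          refine h.congr fun i => ?_
          have hl : 0 < |lam i| := abs_pos.2 (Fact.out (p := SupNeg lam)).neg.ne
          have e : |lam i| ^ (1 / 2 : ℝ) = |lam i| ^ (0 / 2 - 1 / 2 : ℝ) * |lam i| := by
            rw [← Real.rpow_add_one hl.ne']; norm_num
          rw [e, mul_assoc, mul_pow, mul_pow, mul_pow, mul_pow, sq_abs]))
      map_add' := fun x y => by
        refine (WithLp.equiv 2 _).injective (Prod.ext ?_ ?_) <;> apply coeff_injective <;> funext i
        · simp
        · simp [mul_add]
      map_smul' := fun c x => by
        refine (WithLp.equiv 2 _).injective (Prod.ext ?_ ?_) <;> apply coeff_injective <;> funext i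
        · simp
        · simp; ring }

end Wave

/-! ### The strongly continuous semigroup generated by the wave operator -/

/-- `(S t)_{t ≥ 0}` is a strongly continuous semigroup whose generator is `A` (domain included). -/
structure IsSemigroupGeneratedBy {E : Type*} [NormedAddCommGroup E] [NormedSpace ℝ E]
    (A : E →ₗ.[ℝ] E) (S : ℝ → E →L[ℝ] E) : Prop where
  zero : S 0 = ContinuousLinearMap.id ℝ E
  add : ∀ s t : ℝ, 0 ≤ s → 0 ≤ t → S (s + t) = (S s) ∘L (S t)
  continuousOn : ∀ x : E, ContinuousOn (fun t => S t x) (Set.Ici 0)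
  generator : ∀ x y : E,
    (x, y) ∈ A.graph ↔ Tendsto (fun t : ℝ => t⁻¹ • (S t x - x)) (𝓝[>] 0) (𝓝 y)

namespace WaveAux

open InterpSpace

variable {ι : Type*} {lam : ι → ℝ} [Fact (SupNeg lam)]

/-- The frequency `|λ_h| ^ (1/2)`. -/
def freq (lam : ι → ℝ) (i : ι) : ℝ := |lam i| ^ (1 / 2 : ℝ)

theorem lam_abs_pos (i : ι) : 0 < |lam i| := abs_pos.2 (Fact.out (p := SupNeg lam)).neg.ne

theorem freq_pos (i : ι) : 0 < freq lam i := Real.rpow_pos_of_pos (lam_abs_pos i) _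

theorem freq_sq (i : ι) : freq lam i * freq lam i = - lam i := by
  rw [freq, ← Real.rpow_add (lam_abs_pos i)]
  norm_num
  exact (Fact.out (p := SupNeg lam)).neg.le

theorem rpow_neg_half (i : ι) : |lam i| ^ (0 / 2 - 1 / 2 : ℝ) = (freq lam i)⁻¹ := by
  rw [freq, ← Real.rpow_neg (abs_nonneg _)]
  norm_num

/-- Normalized coordinates of the first component. -/
def p : PhaseSpace lam 0 →ₗ[ℝ] (ι → ℝ) where
  toFun x := coeff x.fst
  map_add' x y := by simp
  map_smul' c x := by simp

/-- Normalized coordinates of the second component. -/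
def q : PhaseSpace lam 0 →ₗ[ℝ] (ι → ℝ) where
  toFun x i := (freq lam i)⁻¹ * coeff x.snd i
  map_add' x y := by ext i; simp [mul_add]
  map_smul' c x := by ext i; simp; ring

theorem coeff_snd (x : PhaseSpace lam 0) (i : ι) : coeff x.snd i = freq lam i * q x i :=
  (mul_inv_cancel_left₀ (freq_pos i).ne' _).symm

theorem summable_p (x : PhaseSpace lam 0) : Summable fun i => p x i ^ 2 := by
  refine x.fst.summable.congr fun i => ?_
  simp [p]

theorem summable_q (x : PhaseSpace lam 0) : Summable fun i => q x i ^ 2 := by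
  refine x.snd.summable.congr fun i => ?_
  rw [rpow_neg_half]; rfl

theorem norm_sq (x : PhaseSpace lam 0) : ‖x‖ ^ 2 = ∑' i, (p x i ^ 2 + q x i ^ 2) := by
  rw [(summable_p x).tsum_add (summable_q x), WithLp.prod_norm_sq_eq_of_L2, norm_sq_eq_tsum,
    norm_sq_eq_tsum]
  congr 1
  · exact tsum_congr fun i => by simp [p]
  · exact tsum_congr fun i => by rw [rpow_neg_half]; rfl

theorem summable_pq (x : PhaseSpace lam 0) : Summable fun i => p x i ^ 2 + q x i ^ 2 :=
  (summable_p x).add (summable_q x)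

theorem ext_pq {x y : PhaseSpace lam 0} (hp : p x = p y) (hq : q x = q y) : x = y := by
  refine (WithLp.equiv 2 _).injective (Prod.ext ?_ ?_) <;> apply coeff_injective
  · exact hp
  · funext i
    have := coeff_snd x i
    rw [hq, ← coeff_snd y i] at this
    exact this

/-- The element with given normalized coordinates. -/
def mkPhase (a c : ι → ℝ) (h : Summable fun i => a i ^ 2 + c i ^ 2) : PhaseSpace lam 0 :=
  WithLp.toLp 2
    (mk a (by
      refine Summable.of_nonneg_of_le (fun _ => sq_nonneg _) (fun i => ?_) h
      simpa using sq_nonneg (c i)),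
     mk (fun i => freq lam i * c i) (by
      refine Summable.of_nonneg_of_le (fun _ => sq_nonneg _) (fun i => ?_) h
      rw [rpow_neg_half, inv_mul_cancel_left₀ (freq_pos i).ne']
      nlinarith [sq_nonneg (a i)]))

@[simp] theorem p_mkPhase (a c : ι → ℝ) (h : Summable fun i => a i ^ 2 + c i ^ 2) :
    p (mkPhase (lam := lam) a c h) = a := rfl

@[simp] theorem q_mkPhase (a c : ι → ℝ) (h : Summable fun i => a i ^ 2 + c i ^ 2) :
    q (mkPhase (lam := lam) a c h) = c := by
  funext i
  exact inv_mul_cancel_left₀ (freq_pos i).ne' _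

theorem rot_energy (θ a c : ℝ) :
    (Real.cos θ * a + Real.sin θ * c) ^ 2 + (Real.cos θ * c - Real.sin θ * a) ^ 2
      = a ^ 2 + c ^ 2 := by
  linear_combination (a ^ 2 + c ^ 2) * Real.sin_sq_add_cos_sq θ

/-- The flow of the wave equation, as a function. -/
def flowFun (t : ℝ) (x : PhaseSpace lam 0) : PhaseSpace lam 0 := mkPhase
  (fun i => Real.cos (freq lam i * t) * p x i + Real.sin (freq lam i * t) * q x i)
  (fun i => Real.cos (freq lam i * t) * q x i - Real.sin (freq lam i * t) * p x i)
  ((summable_pq x).congr fun i => (rot_energy _ _ _).symm)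

theorem p_flowFun (t : ℝ) (x : PhaseSpace lam 0) (i : ι) : p (flowFun t x) i =
    Real.cos (freq lam i * t) * p x i + Real.sin (freq lam i * t) * q x i := rfl

theorem q_flowFun (t : ℝ) (x : PhaseSpace lam 0) (i : ι) : q (flowFun t x) i =
    Real.cos (freq lam i * t) * q x i - Real.sin (freq lam i * t) * p x i := by
  rw [flowFun, q_mkPhase]

theorem norm_flowFun (t : ℝ) (x : PhaseSpace lam 0) : ‖flowFun t x‖ = ‖x‖ := by
  rw [← sq_eq_sq₀ (norm_nonneg _) (norm_nonneg _), norm_sq, norm_sq]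
  exact tsum_congr fun i => by rw [p_flowFun, q_flowFun, rot_energy]

/-- The flow of the wave equation, as a linear map. -/
def flowLin (t : ℝ) : PhaseSpace lam 0 →ₗ[ℝ] PhaseSpace lam 0 where
  toFun := flowFun t
  map_add' x y := by
    apply ext_pq <;> funext i <;>
      simp only [map_add, Pi.add_apply, p_flowFun, q_flowFun] <;> ring
  map_smul' c x := by
    apply ext_pq <;> funext i <;>
      simp only [map_smul, Pi.smul_apply, smul_eq_mul, p_flowFun, q_flowFun, RingHom.id_apply] <;>
      ring

/-- The flow of the wave equation. -/
def flow (t : ℝ) : PhaseSpace lam 0 →L[ℝ] PhaseSpace lam 0 :=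
  (flowLin t).mkContinuous 1 fun x => by
    rw [one_mul]
    exact (norm_flowFun t x).le

theorem p_flow (t : ℝ) (x : PhaseSpace lam 0) (i : ι) : p (flow t x) i =
    Real.cos (freq lam i * t) * p x i + Real.sin (freq lam i * t) * q x i := p_flowFun t x i

theorem q_flow (t : ℝ) (x : PhaseSpace lam 0) (i : ι) : q (flow t x) i =
    Real.cos (freq lam i * t) * q x i - Real.sin (freq lam i * t) * p x i := q_flowFun t x i

/-- Convergence from coordinatewise convergence and a summable bound. -/
theorem tendsto_of_coord {α : Type*} {l : Filter α} {f : α → PhaseSpace lam 0} {B : ι → ℝ}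
    (hB : Summable B) (hb : ∀ᶠ a in l, ∀ i, p (f a) i ^ 2 + q (f a) i ^ 2 ≤ B i)
    (hp : ∀ i, Tendsto (fun a => p (f a) i) l (𝓝 0))
    (hq : ∀ i, Tendsto (fun a => q (f a) i) l (𝓝 0)) : Tendsto f l (𝓝 0) := by
  have h : Tendsto (fun a => ∑' i, (p (f a) i ^ 2 + q (f a) i ^ 2)) l (𝓝 (∑' _ : ι, (0 : ℝ))) := by
    refine tendsto_tsum_of_dominated_convergence hB (fun i => ?_) ?_
    · simpa using ((hp i).pow 2).add ((hq i).pow 2)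
    · filter_upwards [hb] with a ha i
      rw [Real.norm_of_nonneg (by positivity)]
      exact ha i
  have h2 : Tendsto (fun a => ‖f a‖ ^ 2) l (𝓝 0) := by
    simpa [norm_sq] using h
  rw [tendsto_zero_iff_norm_tendsto_zero]
  have h3 := h2.sqrt
  simpa using h3

theorem abs_p_le (x : PhaseSpace lam 0) (i : ι) : |p x i| ≤ ‖x‖ := by
  refine abs_le_of_sq_le_sq ?_ (norm_nonneg _)
  rw [norm_sq]
  refine le_trans ?_ ((summable_pq x).le_tsum i fun _ _ => by positivity)
  nlinarith [sq_nonneg (q x i)]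

theorem abs_q_le (x : PhaseSpace lam 0) (i : ι) : |q x i| ≤ ‖x‖ := by
  refine abs_le_of_sq_le_sq ?_ (norm_nonneg _)
  rw [norm_sq]
  refine le_trans ?_ ((summable_pq x).le_tsum i fun _ _ => by positivity)
  nlinarith [sq_nonneg (p x i)]

theorem tendsto_p {α : Type*} {l : Filter α} {f : α → PhaseSpace lam 0} {y : PhaseSpace lam 0}
    (h : Tendsto f l (𝓝 y)) (i : ι) : Tendsto (fun a => p (f a) i) l (𝓝 (p y i)) := by
  rw [tendsto_iff_norm_sub_tendsto_zero] at h ⊢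
  refine squeeze_zero (fun _ => norm_nonneg _) (fun a => ?_) h
  simpa using abs_p_le (f a - y) i

theorem tendsto_q {α : Type*} {l : Filter α} {f : α → PhaseSpace lam 0} {y : PhaseSpace lam 0}
    (h : Tendsto f l (𝓝 y)) (i : ι) : Tendsto (fun a => q (f a) i) l (𝓝 (q y i)) := by
  rw [tendsto_iff_norm_sub_tendsto_zero] at h ⊢
  refine squeeze_zero (fun _ => norm_nonneg _) (fun a => ?_) h
  simpa using abs_q_le (f a - y) i

theorem mem_graph_iff (x y : PhaseSpace lam 0) : (x, y) ∈ (waveOp lam).graph ↔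
    (∀ i, p y i = freq lam i * q x i) ∧ ∀ i, q y i = - (freq lam i * p x i) := by
  have key : ∀ i, (freq lam i)⁻¹ * (lam i * p x i) = -(freq lam i * p x i) := fun i => by
    have h := freq_sq (lam := lam) i
    have h0 := (freq_pos (lam := lam) i).ne'
    field_simp
    linear_combination (p x i) * h
  rw [LinearPMap.mem_graph_iff]
  constructor
  · rintro ⟨z, hz, rfl⟩
    dsimp only at hz
    subst hz
    exact ⟨fun i => coeff_snd z.1 i, key⟩
  · rintro ⟨h1, h2⟩
    have hd : x ∈ (waveOp lam).domain := by
      constructor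
      · refine (summable_q y).congr fun i => ?_
        rw [h2, neg_sq]; rfl
      · refine (summable_p y).congr fun i => ?_
        rw [h1, coeff_snd]; simp
    refine ⟨⟨x, hd⟩, rfl, ext_pq ?_ ?_⟩
    · funext i
      rw [h1]; exact coeff_snd x i
    · funext i
      rw [h2]; exact key i

theorem tendsto_slope (ω a c : ℝ) : Tendsto (fun t : ℝ =>
    t⁻¹ * (Real.cos (ω * t) * a + Real.sin (ω * t) * c - a)) (𝓝[>] 0) (𝓝 (ω * c)) := by
  have h : HasDerivAt (fun t : ℝ => Real.cos (ω * t) * a + Real.sin (ω * t) * c) (ω * c) 0 := by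
    have h0 : HasDerivAt (fun t : ℝ => ω * t) ω 0 := by
      simpa using (hasDerivAt_id (0 : ℝ)).const_mul ω
    exact ((h0.cos.mul_const a).add (h0.sin.mul_const c)).congr_deriv (by simp)
  have h2 := h.tendsto_slope_zero_right
  simpa using h2

theorem slope_bound (ω a c t : ℝ) (hω : 0 < ω) (ht : 0 < t) :
    |t⁻¹ * (Real.cos (ω * t) * a + Real.sin (ω * t) * c - a) - ω * c|
      ≤ ω * |a| + 2 * (ω * |c|) := by
  have hs : |Real.sin (ω * t)| ≤ ω * t := by
    simpa [abs_of_pos (mul_pos hω ht)] using Real.abs_sin_le_abs (x := ω * t)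
  have hc : |Real.cos (ω * t) - 1| ≤ ω * t := by
    have h := Real.abs_cos_sub_cos_le (ω * t) 0
    simpa [abs_of_pos (mul_pos hω ht)] using h
  have e : t⁻¹ * (Real.cos (ω * t) * a + Real.sin (ω * t) * c - a) - ω * c
      = t⁻¹ * (Real.cos (ω * t) - 1) * a + (t⁻¹ * Real.sin (ω * t) * c - ω * c) := by ring
  have hs' : |t⁻¹ * Real.sin (ω * t)| ≤ ω := by
    rw [abs_mul, abs_of_pos (inv_pos.2 ht), inv_mul_le_iff₀ ht, mul_comm t]; exact hs
  have hc' : |t⁻¹ * (Real.cos (ω * t) - 1)| ≤ ω := by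
    rw [abs_mul, abs_of_pos (inv_pos.2 ht), inv_mul_le_iff₀ ht, mul_comm t]; exact hc
  rw [e]
  refine (abs_add_le _ _).trans (add_le_add ?_ ?_)
  · rw [abs_mul]; gcongr
  · refine (abs_sub _ _).trans ?_
    rw [abs_mul _ c, abs_mul ω c, abs_of_pos hω]
    nlinarith [mul_le_mul_of_nonneg_right hs' (abs_nonneg c)]

theorem isSemigroupGeneratedBy_flow :
    IsSemigroupGeneratedBy (waveOp lam) (fun t => flow (lam := lam) t) where
  zero := by
    ext1 x
    apply ext_pq <;> funext i <;> simp [p_flow, q_flow]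
  add s t _ _ := by
    ext1 x
    apply ext_pq <;> funext i <;>
      simp only [ContinuousLinearMap.comp_apply, p_flow, q_flow, mul_add, Real.cos_add,
        Real.sin_add] <;> ring
  continuousOn x := by
    refine Continuous.continuousOn (continuous_iff_continuousAt.2 fun t => ?_)
    rw [ContinuousAt, ← tendsto_sub_nhds_zero_iff]
    refine tendsto_of_coord ((summable_pq x).mul_left 4) (Eventually.of_forall fun s i => ?_)
      (fun i => ?_) (fun i => ?_)
    · have e1 := rot_energy (freq lam i * s) (p x i) (q x i)
      have e2 := rot_energy (freq lam i * t) (p x i) (q x i)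
      rw [← p_flow, ← q_flow] at e1 e2
      simp only [map_sub, Pi.sub_apply]
      nlinarith [sq_nonneg (p (flow s x) i + p (flow t x) i),
        sq_nonneg (q (flow s x) i + q (flow t x) i)]
    · simp only [map_sub, Pi.sub_apply, p_flow]
      refine tendsto_sub_nhds_zero_iff.2 (Continuous.tendsto ?_ _)
      fun_prop
    · simp only [map_sub, Pi.sub_apply, q_flow]
      refine tendsto_sub_nhds_zero_iff.2 (Continuous.tendsto ?_ _)
      fun_prop
  generator x y := by
    have hp : ∀ i, Tendsto (fun t : ℝ => p (t⁻¹ • (flow t x - x)) i) (𝓝[>] 0)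
        (𝓝 (freq lam i * q x i)) := fun i => by
      simpa [p_flow] using tendsto_slope (freq lam i) (p x i) (q x i)
    have hq : ∀ i, Tendsto (fun t : ℝ => q (t⁻¹ • (flow t x - x)) i) (𝓝[>] 0)
        (𝓝 (-(freq lam i * p x i))) := fun i => by
      simpa [q_flow, sub_eq_add_neg, mul_add] using tendsto_slope (freq lam i) (q x i) (-p x i)
    rw [mem_graph_iff]
    constructor
    · rintro ⟨h1, h2⟩
      rw [← tendsto_sub_nhds_zero_iff]
      refine tendsto_of_coord ((summable_pq y).mul_left 10) ?_ (fun i => ?_) (fun i => ?_)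
      · filter_upwards [self_mem_nhdsWithin] with t ht i
        have b1 := slope_bound (freq lam i) (p x i) (q x i) t (freq_pos i) ht
        have b2 := slope_bound (freq lam i) (q x i) (-p x i) t (freq_pos i) ht
        have e1 : p (t⁻¹ • (flow t x - x) - y) i = t⁻¹ * (Real.cos (freq lam i * t) * p x i +
            Real.sin (freq lam i * t) * q x i - p x i) - freq lam i * q x i := by
          simp [p_flow, h1]
        have e2 : q (t⁻¹ • (flow t x - x) - y) i = t⁻¹ * (Real.cos (freq lam i * t) * q x i +
            Real.sin (freq lam i * t) * -p x i - q x i) - freq lam i * -p x i := by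
          simp [q_flow, h2, sub_eq_add_neg, mul_add]
        rw [← e1] at b1
        rw [← e2, abs_neg] at b2
        have a1 : |p y i| = freq lam i * |q x i| := by
          rw [h1, abs_mul, abs_of_pos (freq_pos i)]
        have a2 : |q y i| = freq lam i * |p x i| := by
          rw [h2, abs_neg, abs_mul, abs_of_pos (freq_pos i)]
        rw [← a1, ← a2] at b1
        rw [← a1, ← a2] at b2
        rw [← sq_abs (p _ i), ← sq_abs (q _ i), ← sq_abs (p y i), ← sq_abs (q y i)]
        have c1 := pow_le_pow_left₀ (abs_nonneg _) b1 2
        have c2 := pow_le_pow_left₀ (abs_nonneg _) b2 2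
        nlinarith [sq_nonneg (|p y i| - |q y i|)]
      · simpa [h1] using (hp i).sub_const (p y i)
      · simpa [h2] using (hq i).sub_const (q y i)
    · intro h
      exact ⟨fun i => tendsto_nhds_unique (tendsto_p h i) (hp i),
        fun i => tendsto_nhds_unique (tendsto_q h i) (hq i)⟩

end WaveAux

/-- The strongly continuous semigroup `(e^{t 𝐀})_{t ≥ 0}` generated by the wave operator `𝐀`. It
exists by the facts above, and a semigroup is determined by its generator. -/
def waveSemigroup {ι : Type*} (lam : ι → ℝ) [Fact (SupNeg lam)] :
    ℝ → PhaseSpace lam 0 →L[ℝ] PhaseSpace lam 0 :=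
  Classical.choose (⟨_, WaveAux.isSemigroupGeneratedBy_flow⟩ :
    ∃ S, IsSemigroupGeneratedBy (waveOp lam) S)

theorem waveSemigroup_spec {ι : Type*} (lam : ι → ℝ) [Fact (SupNeg lam)] :
    IsSemigroupGeneratedBy (waveOp lam) (waveSemigroup lam) :=
  Classical.choose_spec (⟨_, WaveAux.isSemigroupGeneratedBy_flow⟩ :
    ∃ S, IsSemigroupGeneratedBy (waveOp lam) S)

/-! ### The noise operator -/

/-- The operator `𝐁 v = (0, ∑_h μ_h ⟨h, v⟩_H h)` from `H` to `𝐇_0`. -/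
def noiseOp {ι H : Type*} [NormedAddCommGroup H] [InnerProductSpace ℝ H]
    (b : HilbertBasis ι ℝ H) (lam : ι → ℝ) [Fact (SupNeg lam)] (mu : ι → ℝ)
    (hmu : Summable fun i => mu i ^ 2 / |lam i|) : H →L[ℝ] PhaseSpace lam 0 :=
  have bound : ∀ (v : H) (i : ι), (|lam i| ^ (0 / 2 - 1 / 2 : ℝ) * (mu i * inner ℝ (b i) v)) ^ 2
      ≤ mu i ^ 2 / |lam i| * ‖v‖ ^ 2 := fun v i => by
    have h1 : (|lam i| ^ (0 / 2 - 1 / 2 : ℝ)) ^ 2 = |lam i|⁻¹ := by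
      rw [← Real.rpow_natCast, ← Real.rpow_mul (abs_nonneg _), ← Real.rpow_neg_one]
      norm_num
    have h2 : (inner ℝ (b i) v) ^ 2 ≤ ‖v‖ ^ 2 := by
      have := abs_real_inner_le_norm (b i) v
      rw [b.orthonormal.1 i, one_mul] at this
      exact sq_le_sq.2 (by rwa [abs_norm])
    rw [mul_pow, mul_pow, h1, div_eq_inv_mul, mul_assoc]
    gcongr
  have summ : ∀ v : H, Summable fun i =>
      (|lam i| ^ (0 / 2 - 1 / 2 : ℝ) * (mu i * inner ℝ (b i) v)) ^ 2 := fun v =>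
    Summable.of_nonneg_of_le (fun _ => sq_nonneg _) (bound v) (hmu.mul_right _)
  LinearMap.mkContinuous
    { toFun := fun v =>
        WithLp.toLp 2 (0, InterpSpace.mk (fun i => mu i * inner ℝ (b i) v) (summ v))
      map_add' := fun v w => by
        refine (WithLp.equiv 2 _).injective (Prod.ext ?_ ?_) <;>
          apply InterpSpace.coeff_injective <;> funext i
        · simp
        · simp [inner_add_right, mul_add]
      map_smul' := fun c v => by
        refine (WithLp.equiv 2 _).injective (Prod.ext ?_ ?_) <;>
          apply InterpSpace.coeff_injective <;> funext i
        · simp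
        · simp [inner_smul_right]; ring }
    (√(∑' i, mu i ^ 2 / |lam i|)) (fun v => by
      have h0 : 0 ≤ ∑' i, mu i ^ 2 / |lam i| := tsum_nonneg fun i => by positivity
      refine le_of_sq_le_sq ?_ (by positivity)
      rw [mul_pow, Real.sq_sqrt h0, WithLp.prod_norm_sq_eq_of_L2, ← tsum_mul_right]
      simp only [LinearMap.coe_mk, AddHom.coe_mk, WithLp.toLp_fst, WithLp.toLp_snd, norm_zero]
      rw [InterpSpace.norm_sq_eq_tsum, zero_pow two_ne_zero, zero_add]
      exact (summ v).tsum_le_tsum (bound v) (hmu.mul_right _))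

/-! ### Cylindrical Wiener processes and the stochastic integral -/

section Stochastic

variable {ι H K Ω : Type*} [NormedAddCommGroup H] [InnerProductSpace ℝ H]
  [NormedAddCommGroup K] [InnerProductSpace ℝ K] [mΩ : MeasurableSpace Ω]
  {T : ℝ}

/-- A normal filtration: right-continuous, and all events of probability zero lie in `𝓕_0`
(equivalently in every `𝓕_t`). -/
structure IsNormalFiltration (P : Measure Ω) (𝓕 : Filtration (Set.Icc (0 : ℝ) T) mΩ) : Prop where
  null : ∀ (t : Set.Icc (0 : ℝ) T) (s : Set Ω), MeasurableSet s → P s = 0 → MeasurableSet[𝓕 t] s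
  rightContinuous : 𝓕.IsRightContinuous

/-- `(W_t)_{t ∈ [0,T]}` is an `id_H`-cylindrical Wiener process with respect to `𝓕`; here
`W t v` plays the role of `⟨v, W_t⟩_H`. -/
structure IsCylindricalWiener (P : Measure Ω) (𝓕 : Filtration (Set.Icc (0 : ℝ) T) mΩ)
    (W : Set.Icc (0 : ℝ) T → H → Ω → ℝ) : Prop where
  adapted : ∀ t v, Measurable[𝓕 t] (W t v)
  zero : ∀ (t : Set.Icc (0 : ℝ) T) v, (t : ℝ) = 0 → W t v =ᵐ[P] 0
  map_add : ∀ t v w, W t (v + w) =ᵐ[P] W t v + W t w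
  map_smul : ∀ t (c : ℝ) v, W t (c • v) =ᵐ[P] c • W t v
  gaussian : ∀ s t : Set.Icc (0 : ℝ) T, s ≤ t → ∀ v,
    P.map (W t v - W s v) = gaussianReal 0 (Real.toNNReal (((t : ℝ) - s) * ‖v‖ ^ 2))
  indep : ∀ s t, s ≤ t → ∀ v,
    Indep (MeasurableSpace.comap (W t v - W s v) inferInstance) (𝓕 s) P
  continuous : ∀ v, ∀ᵐ ω ∂P, Continuous fun t => W t v ω

/-- An elementary (deterministic) integrand
`∑_{k < n} 1_{(t_k, t_{k+1}]} ∑_{j < m} ⟨v_{k,j}, ·⟩_H x_{k,j}`, a step function whose values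
are operators of finite rank from `H` to `K`. -/
structure ElemIntegrand (T : ℝ) (H K : Type*) where
  /-- number of time intervals -/
  n : ℕ
  /-- bound for the ranks -/
  m : ℕ
  /-- the time grid -/
  t : ℕ → Set.Icc (0 : ℝ) T
  mono : Monotone t
  /-- input vectors -/
  v : ℕ → ℕ → H
  /-- output vectors -/
  x : ℕ → ℕ → K

namespace ElemIntegrand

/-- The elementary integrand as an operator-valued function of time. -/
def eval (E : ElemIntegrand T H K) (s : Set.Icc (0 : ℝ) T) : H →L[ℝ] K :=
  ∑ k ∈ Finset.range E.n, (Set.Ioc (E.t k) (E.t (k + 1))).indicator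
    (fun _ => ∑ j ∈ Finset.range E.m, (innerSL ℝ (E.v k j)).smulRight (E.x k j)) s

/-- The stochastic integral of an elementary integrand. -/
def integral (E : ElemIntegrand T H K) (W : Set.Icc (0 : ℝ) T → H → Ω → ℝ) (ω : Ω) : K :=
  ∑ k ∈ Finset.range E.n, ∑ j ∈ Finset.range E.m,
    (W (E.t (k + 1)) (E.v k j) ω - W (E.t k) (E.v k j) ω) • E.x k j

end ElemIntegrand

/-- The square `∑_h ‖L h‖ ^ 2` of the Hilbert-Schmidt norm of `L`. -/
def hsNormSq (b : HilbertBasis ι ℝ H) (L : H →L[ℝ] K) : ℝ≥0∞ := ∑' i, ‖L (b i)‖ₑ ^ 2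

/-- `Y = ∫_0^T Φ_s dW_s` almost surely, for a deterministic integrand `Φ : [0,T] → HS(H, K)`. The
stochastic integral is the extension by continuity of the integral of elementary integrands, from
`L²([0,T]; HS(H, K))` to `L²(P; K)`. -/
def IsStochIntegral (b : HilbertBasis ι ℝ H) (P : Measure Ω)
    (W : Set.Icc (0 : ℝ) T → H → Ω → ℝ) (Φ : Set.Icc (0 : ℝ) T → H →L[ℝ] K) (Y : Ω → K) : Prop :=
  (∀ v, AEStronglyMeasurable (fun s => Φ s v) ((volume : Measure ℝ).comap (↑))) ∧
  AEStronglyMeasurable Y P ∧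
  ∃ E : ℕ → ElemIntegrand T H K,
    Tendsto (fun n => ∫⁻ s, hsNormSq b ((E n).eval s - Φ s) ∂((volume : Measure ℝ).comap (↑)))
      atTop (𝓝 0) ∧
    Tendsto (fun n => ∫⁻ ω, ‖(E n).integral W ω - Y ω‖ₑ ^ 2 ∂P) atTop (𝓝 0)

end Stochastic

/-! ### The test functions -/

/-- `C²_b(V, ℝ)`: the bounded, twice continuously Fréchet differentiable functions with bounded
first and second derivative. -/
def IsCbTwo {V : Type*} [NormedAddCommGroup V] [NormedSpace ℝ V] (φ : V → ℝ) : Prop :=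
  ContDiff ℝ 2 φ ∧ ∃ C : ℝ, ∀ x, |φ x| ≤ C ∧ ‖fderiv ℝ φ x‖ ≤ C ∧ ‖fderiv ℝ (fderiv ℝ φ) x‖ ≤ C

section Test

variable {ι : Type*} (lam : ι → ℝ) [Fact (SupNeg lam)]

/-- For `x = (v_1, v_2) ∈ 𝐇_0` the number `‖v_i‖²` in `H_{1/2-i/2}`, where the indices `0, 1` of
`Fin 2` stand for `i = 1, 2`; so it is `‖v_1‖²` in `H_0`, and `‖v_2‖²` in `H_{-1/2}`. -/
def compNormSq (i : Fin 2) (x : PhaseSpace lam 0) : ℝ := ![‖x.fst‖ ^ 2, ‖x.snd‖ ^ 2] i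

/-- The test function `φ_i (v_1, v_2) = exp (-‖v_i‖²)`. -/
def testFun (i : Fin 2) (x : PhaseSpace lam 0) : ℝ := Real.exp (-compNormSq lam i x)

end Test

end

/-!
The coordinates of the stochastic convolution `X I` with respect to the eigenbasis are independent
centered Gaussian variables, of variance `a h` for `h ∈ I` and `0` for `h ∉ I`, where for the first
component `a h = (μ_h² / |λ_h|) ∫ sin² (|λ_h|^{1/2} (T - s)) ds`, with `cos²` instead of `sin²` for
the second one (`WaveAux.map_sum_coord`). So `E ‖X I‖²` is the sum of `a` over `I`
(`integrable_tsum_sq`) and `E exp (-‖X I‖²)` is the product of the `(1 + 2 a h)^{-1/2}` over `I`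
(`tendsto_prod_integral_exp_neg_tsum_sq`), and the estimate becomes an inequality between sums and
products of numbers, to be shown over finite sets of indices (`sum_div_exp_le_prod_sub_prod`).

The law of `X I` comes from three facts. A semigroup is determined by its generator, so that
`e^{t𝐀}` is the flow that rotates each mode (`waveSemigroup_eq_flow`). For an elementary integrand
the increments of the Wiener process over the grid are independent, so that a functional `ℓ` of the
stochastic integral is Gaussian with variance `∫ ‖ℓ ∘ Φ_s‖² ds`
(`ElemIntegrand.map_dual_integral`). This passes to `L²` limits by means of characteristic functions
(`IsStochIntegral.map_dual`).
-/

/-! ### Smoothness of the test functions -/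

set_option maxSynthPendingDepth 3 in
/-- The first derivative of `x ↦ exp (-‖L x‖²)` is `exp (-‖L x‖²) • M x` with the linear map
`M = -2 ⟪L ·, L ·⟫`, so the second one is `exp (-‖L x‖²) • (M + M x ⊗ M x)`; a Gaussian dominates
the quadratic growth of `M x ⊗ M x`. -/
theorem isCbTwo_exp_neg_norm_sq {V G : Type*} [NormedAddCommGroup V] [NormedSpace ℝ V]
    [NormedAddCommGroup G] [InnerProductSpace ℝ G] (L : V →L[ℝ] G) (hL : ‖L‖ ≤ 1) :
    IsCbTwo fun x => Real.exp (-‖L x‖ ^ 2) := by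
  set φ : V → ℝ := fun x => Real.exp (-‖L x‖ ^ 2) with hφ
  have hsmooth : ContDiff ℝ 2 φ := ((L.contDiff.norm_sq ℝ).neg).exp
  let M : V →L[ℝ] V →L[ℝ] ℝ :=
    (-2 : ℝ) • (((ContinuousLinearMap.compL ℝ V G ℝ).flip L) ∘L (innerSL ℝ) ∘L L)
  have hM : ∀ x y, M x y = -2 * inner ℝ (L x) (L y) := fun x y => rfl
  have hLx : ∀ x, ‖L x‖ ≤ ‖x‖ := fun x => by
    simpa using L.le_of_opNorm_le hL x
  have hMx : ∀ x, ‖M x‖ ≤ 2 * ‖L x‖ := fun x => by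
    refine ContinuousLinearMap.opNorm_le_bound _ (by positivity) fun y => ?_
    rw [hM, norm_mul, norm_neg, Real.norm_ofNat, mul_assoc]
    gcongr
    exact (norm_inner_le_norm _ _).trans (by gcongr; exact hLx y)
  have hMn : ‖M‖ ≤ 2 := by
    refine ContinuousLinearMap.opNorm_le_bound _ (by positivity) fun x => (hMx x).trans ?_
    gcongr
    exact hLx x
  have hφ1 : ∀ x, φ x ≤ 1 := fun x => Real.exp_le_one_iff.2 (by simp)
  have hφ0 : ∀ x, 0 ≤ φ x := fun x => (Real.exp_pos _).le
  have hφq : ∀ x, φ x * ‖L x‖ ^ 2 ≤ 1 := fun x => by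
    have h : ‖L x‖ ^ 2 ≤ Real.exp (‖L x‖ ^ 2) := by
      linarith [Real.add_one_le_exp (‖L x‖ ^ 2)]
    calc φ x * ‖L x‖ ^ 2 ≤ φ x * Real.exp (‖L x‖ ^ 2) := by gcongr
      _ = 1 := by rw [hφ]; simp [← Real.exp_add]
  have hφl : ∀ x, φ x * ‖L x‖ ≤ 1 := fun x => by
    nlinarith [hφq x, hφ0 x, hφ1 x, mul_nonneg (hφ0 x) (sq_nonneg (‖L x‖ - 1))]
  have hd : ∀ x, HasFDerivAt φ (φ x • M x) x := fun x => by
    refine (((L.hasFDerivAt (x := x)).norm_sq).neg.exp).congr_fderiv ?_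
    ext y
    simp [hM, hφ]
  have hd1 : fderiv ℝ φ = fun x => φ x • M x := funext fun x => (hd x).fderiv
  have hd2 : ∀ x, fderiv ℝ (fderiv ℝ φ) x = φ x • M + (φ x • M x).smulRight (M x) := fun x => by
    rw [hd1]
    exact ((hd x).smul M.hasFDerivAt).fderiv
  refine ⟨hsmooth, 6, fun x => ⟨?_, ?_, ?_⟩⟩
  · rw [abs_of_nonneg (hφ0 x)]
    linarith [hφ1 x]
  · rw [hd1, norm_smul, Real.norm_of_nonneg (hφ0 x)]
    nlinarith [mul_le_mul_of_nonneg_left (hMx x) (hφ0 x), hφl x]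
  · rw [hd2]
    refine (norm_add_le (φ x • M) ((φ x • M x).smulRight (M x))).trans ?_
    rw [ContinuousLinearMap.norm_smulRight_apply, norm_smul (φ x) M, norm_smul (φ x) (M x),
      Real.norm_of_nonneg (hφ0 x)]
    have h1 : φ x * ‖M‖ ≤ 1 * 2 := mul_le_mul (hφ1 x) hMn (norm_nonneg _) zero_le_one
    have h2 : φ x * ‖M x‖ * ‖M x‖ ≤ φ x * (2 * ‖L x‖) * (2 * ‖L x‖) := by
      have := hφ0 x
      gcongr <;> exact hMx x
    nlinarith [hφq x]

theorem isCbTwo_testFun {ι : Type*} (lam : ι → ℝ) [Fact (SupNeg lam)] (i : Fin 2) :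
    IsCbTwo (testFun lam i) := by
  fin_cases i
  · refine isCbTwo_exp_neg_norm_sq
      (WithLp.fstL 2 ℝ (InterpSpace lam (0 / 2)) (InterpSpace lam (0 / 2 - 1 / 2)))
      (ContinuousLinearMap.opNorm_le_bound _ zero_le_one fun x => ?_)
    rw [one_mul]
    exact WithLp.norm_fst_le (InterpSpace lam (0 / 2)) x
  · refine isCbTwo_exp_neg_norm_sq
      (WithLp.sndL 2 ℝ (InterpSpace lam (0 / 2)) (InterpSpace lam (0 / 2 - 1 / 2)))
      (ContinuousLinearMap.opNorm_le_bound _ zero_le_one fun x => ?_)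
    rw [one_mul]
    exact WithLp.norm_snd_le (InterpSpace lam (0 / 2)) x

/-! ### Gaussian Laplace transforms and their products -/

theorem integral_exp_neg_sq_gaussianReal (v : ℝ≥0) :
    ∫ x, Real.exp (-x ^ 2) ∂(gaussianReal 0 v) = (√(1 + 2 * v))⁻¹ := by
  rcases eq_or_ne v 0 with rfl | hv
  · simp
  have hv' : (0 : ℝ) < v := NNReal.coe_pos.2 (pos_iff_ne_zero.2 hv)
  rw [integral_gaussianReal_eq_integral_smul hv]
  have h : ∀ x : ℝ, gaussianPDFReal 0 v x • Real.exp (-x ^ 2)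
      = (√(2 * Real.pi * v))⁻¹ * Real.exp (-(1 + (2 * v : ℝ)⁻¹) * x ^ 2) := fun x => by
    rw [gaussianPDFReal, smul_eq_mul, mul_assoc, ← Real.exp_add]
    congr 2
    field_simp
    ring
  simp only [h]
  rw [integral_const_mul, integral_gaussian, ← Real.sqrt_inv, ← Real.sqrt_inv, ← Real.sqrt_mul
    (by positivity)]
  congr 1
  field_simp
  ring

theorem exp_neg_le_inv_sqrt {x : ℝ} (hx : 0 ≤ x) : Real.exp (-x) ≤ (√(1 + 2 * x))⁻¹ := by
  rw [Real.exp_neg]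
  refine inv_anti₀ (by positivity) (Real.sqrt_le_iff.2 ⟨(Real.exp_pos _).le, ?_⟩)
  rw [← Real.exp_nat_mul]
  linarith [Real.add_one_le_exp ((2 : ℕ) * x), show ((2 : ℕ) : ℝ) * x = 2 * x by norm_num]

theorem mul_exp_le_one_sub_inv_sqrt {s : ℝ} (hs : 0 ≤ s) :
    s * Real.exp (-(2 * s)) ≤ 1 - (√(1 + 2 * s))⁻¹ := by
  set r := √(1 + 2 * s) with hr
  have hr2 : r ^ 2 = 1 + 2 * s := Real.sq_sqrt (by positivity)
  have hr1 : 1 ≤ r := Real.one_le_sqrt.2 (by linarith)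
  have he : Real.exp (-(2 * s)) ≤ (r ^ 2)⁻¹ := by
    rw [Real.exp_neg, hr2]
    exact inv_anti₀ (by positivity) (by linarith [Real.add_one_le_exp (2 * s)])
  calc s * Real.exp (-(2 * s)) ≤ s * (r ^ 2)⁻¹ := by gcongr
    _ ≤ 1 - r⁻¹ := by
      have hr0 : 0 < r := by linarith
      rw [← div_eq_mul_inv, div_le_iff₀ (by positivity)]
      have : (1 - r⁻¹) * r ^ 2 = r ^ 2 - r := by field_simp
      rw [this]
      nlinarith

theorem one_add_two_mul_sum_le_prod {ι : Type*} (F : Finset ι) {d : ι → ℝ} (hd : ∀ i, 0 ≤ d i) :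
    1 + 2 * ∑ i ∈ F, d i ≤ ∏ i ∈ F, (1 + 2 * d i) := by
  classical
  induction F using Finset.induction_on with
  | empty => simp
  | insert i F hi ih =>
    rw [Finset.sum_insert hi, Finset.prod_insert hi]
    have h := Finset.sum_nonneg fun j (_ : j ∈ F) => hd j
    nlinarith [hd i, mul_le_mul_of_nonneg_left ih (show 0 ≤ 1 + 2 * d i by linarith [hd i]),
      mul_nonneg (hd i) h]

/-- The finite-dimensional form of the estimate. Splitting off the coordinates outside `I` from the
product leaves the factor `1 - ∏ (1 + 2 a_i)^{-1/2} ≥ 1 - (1 + 2 s)^{-1/2} ≥ s e^{-2 s}`, where `s` is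
the sum of the `a_i` with `i ∉ I`; the product over `I` is at least `e^{-σ}`, with `σ` the sum over
`I`. As `σ + 2 s ≤ 2 (σ + s)`, the constant `6` is not sharp. -/
theorem sum_div_exp_le_prod_sub_prod {ι : Type*} (F : Finset ι) (I : Set ι) {a : ι → ℝ}
    (ha : ∀ i, 0 ≤ a i) :
    (∑ i ∈ F, a i - ∑ i ∈ F, I.indicator a i) / Real.exp (6 * ∑ i ∈ F, a i) ≤
      ∏ i ∈ F, (√(1 + 2 * I.indicator a i))⁻¹ - ∏ i ∈ F, (√(1 + 2 * a i))⁻¹ := by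
  set u := I.indicator a with hu
  set d := Iᶜ.indicator a with hd
  have hu0 : ∀ i, 0 ≤ u i := fun i => Set.indicator_nonneg (fun i _ => ha i) i
  have hd0 : ∀ i, 0 ≤ d i := fun i => Set.indicator_nonneg (fun i _ => ha i) i
  have hadd : ∀ i, a i = u i + d i := fun i => (Set.indicator_self_add_compl_apply I a i).symm
  have hmul : ∀ i, √(1 + 2 * a i) = √(1 + 2 * u i) * √(1 + 2 * d i) := fun i => by
    by_cases hi : i ∈ I <;> simp [hu, hd, hi]
  set s := ∑ i ∈ F, d i with hs
  set σ := ∑ i ∈ F, u i with hσ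
  have hs0 : 0 ≤ s := Finset.sum_nonneg fun i _ => hd0 i
  have hσ0 : 0 ≤ σ := Finset.sum_nonneg fun i _ => hu0 i
  have hsum : ∑ i ∈ F, a i = σ + s := by
    rw [hσ, hs, ← Finset.sum_add_distrib]
    exact Finset.sum_congr rfl fun i _ => hadd i
  have hprod : ∏ i ∈ F, (√(1 + 2 * a i))⁻¹
      = (∏ i ∈ F, (√(1 + 2 * u i))⁻¹) * ∏ i ∈ F, (√(1 + 2 * d i))⁻¹ := by
    rw [← Finset.prod_mul_distrib]
    exact Finset.prod_congr rfl fun i _ => by rw [hmul, mul_inv]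
  have h1 : Real.exp (-σ) ≤ ∏ i ∈ F, (√(1 + 2 * u i))⁻¹ := by
    rw [hσ, ← Finset.sum_neg_distrib, Real.exp_sum]
    exact Finset.prod_le_prod (fun i _ => (Real.exp_pos _).le)
      fun i _ => exp_neg_le_inv_sqrt (hu0 i)
  have h2 : ∏ i ∈ F, (√(1 + 2 * d i))⁻¹ ≤ (√(1 + 2 * s))⁻¹ := by
    rw [Finset.prod_inv_distrib, ← Real.sqrt_prod _ fun i _ => by linarith [hd0 i]]
    exact inv_anti₀ (by positivity) (Real.sqrt_le_sqrt (one_add_two_mul_sum_le_prod F hd0))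
  have h3 := mul_exp_le_one_sub_inv_sqrt hs0
  rw [hsum, hprod, add_sub_cancel_left, div_eq_mul_inv, ← Real.exp_neg]
  calc s * Real.exp (-(6 * (σ + s))) ≤ s * Real.exp (-σ + -(2 * s)) := by
        gcongr
        linarith
    _ = Real.exp (-σ) * (s * Real.exp (-(2 * s))) := by rw [Real.exp_add]; ring
    _ ≤ (∏ i ∈ F, (√(1 + 2 * u i))⁻¹) * (1 - ∏ i ∈ F, (√(1 + 2 * d i))⁻¹) := by
        refine mul_le_mul h1 (by linarith) (by positivity) ?_
        exact Finset.prod_nonneg fun i _ => by positivity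
    _ = _ := by ring

/-! ### The semigroup generated by the wave operator is the explicit flow -/

/-- Coordinatewise a semigroup generated by the wave operator solves the equation of a harmonic
oscillator, with derivatives from the right. -/
theorem WaveAux.hasDerivWithinAt_coord {ι : Type*} {lam : ι → ℝ} [Fact (SupNeg lam)]
    {S : ℝ → PhaseSpace lam 0 →L[ℝ] PhaseSpace lam 0}
    (hS : IsSemigroupGeneratedBy (waveOp lam) S) {x y : PhaseSpace lam 0}
    (hxy : (x, y) ∈ (waveOp lam).graph) {t : ℝ} (ht : 0 ≤ t) (i : ι) :
    HasDerivWithinAt (fun s => p (S s x) i) (freq lam i * q (S t x) i) (Set.Ici t) t ∧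
    HasDerivWithinAt (fun s => q (S s x) i) (-(freq lam i * p (S t x) i)) (Set.Ici t) t := by
  have h0 : Tendsto (fun h : ℝ => h⁻¹ • (S h (S t x) - S t x)) (𝓝[>] 0) (𝓝 (S t y)) := by
    refine (((S t).continuous.tendsto y).comp ((hS.generator x y).1 hxy)).congr' ?_
    filter_upwards [self_mem_nhdsWithin] with h hh
    have hh' : 0 ≤ h := le_of_lt hh
    have e : S h (S t x) = S t (S h x) := by
      rw [← ContinuousLinearMap.comp_apply, ← ContinuousLinearMap.comp_apply, ← hS.add h t hh' ht,
        ← hS.add t h ht hh', add_comm]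
    simp [e]
  obtain ⟨hp, hq⟩ := (mem_graph_iff _ _).1 ((hS.generator _ _).2 h0)
  have h1 : Tendsto (fun h : ℝ => h⁻¹ • (S (t + h) x - S t x)) (𝓝[>] 0) (𝓝 (S t y)) := by
    refine h0.congr' ?_
    filter_upwards [self_mem_nhdsWithin] with h hh
    rw [add_comm t h, hS.add h t (le_of_lt hh) ht]; rfl
  have key : ∀ (c : PhaseSpace lam 0 → ℝ) (z : ℝ),
      Tendsto (fun h : ℝ => h⁻¹ * (c (S (t + h) x) - c (S t x))) (𝓝[>] 0) (𝓝 z) →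
      HasDerivWithinAt (fun s => c (S s x)) z (Set.Ici t) t := fun c z h => by
    rw [hasDerivWithinAt_iff_tendsto_slope, Set.Ici_sdiff_left]
    have hm : Tendsto (fun s : ℝ => s - t) (𝓝[>] t) (𝓝[>] 0) := by
      refine tendsto_nhdsWithin_iff.2 ⟨?_, ?_⟩
      · have : Tendsto (fun s : ℝ => s - t) (𝓝 t) (𝓝 (t - t)) := tendsto_id.sub_const t
        rw [sub_self] at this
        exact this.mono_left nhdsWithin_le_nhds
      · filter_upwards [self_mem_nhdsWithin] with s hs
        exact sub_pos.2 (Set.mem_Ioi.1 hs)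
    refine (h.comp hm).congr fun s => ?_
    simp [slope_def_field, div_eq_inv_mul]
  constructor
  · refine key (fun z => p z i) _ ?_
    rw [← hp]
    exact (tendsto_p h1 i).congr fun h => by simp
  · refine key (fun z => q z i) _ ?_
    rw [← hq]
    exact (tendsto_q h1 i).congr fun h => by simp

/-- On the domain of the generator: rotating the oscillator back gives a constant. -/
theorem WaveAux.eq_flow_of_mem_graph {ι : Type*} {lam : ι → ℝ} [Fact (SupNeg lam)]
    {S : ℝ → PhaseSpace lam 0 →L[ℝ] PhaseSpace lam 0}
    (hS : IsSemigroupGeneratedBy (waveOp lam) S) {x y : PhaseSpace lam 0}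
    (hxy : (x, y) ∈ (waveOp lam).graph) {t : ℝ} (ht : 0 ≤ t) : S t x = flow t x := by
  have hcont : ContinuousOn (fun s => S s x) (Set.Icc 0 t) :=
    (hS.continuousOn x).mono Set.Icc_subset_Ici_self
  have key : ∀ i, p (S t x) i = Real.cos (freq lam i * t) * p x i
        + Real.sin (freq lam i * t) * q x i ∧
      q (S t x) i = Real.cos (freq lam i * t) * q x i
        - Real.sin (freq lam i * t) * p x i := fun i => by
    set ω := freq lam i
    -- `e1` and `e2` say that the coordinates, rotated back by the angle `ω * t`, are those of `x`.
    have hpc : ContinuousOn (fun s => p (S s x) i) (Set.Icc 0 t) := fun s hs =>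
      tendsto_p (hcont s hs) i
    have hqc : ContinuousOn (fun s => q (S s x) i) (Set.Icc 0 t) := fun s hs =>
      tendsto_q (hcont s hs) i
    have hlin : ∀ s, HasDerivWithinAt (fun r : ℝ => ω * r) ω (Set.Ici s) s := fun s => by
      simpa using (hasDerivWithinAt_id s (Set.Ici s)).const_mul ω
    have e1 := constant_of_has_deriv_right_zero
      (f := fun s => Real.cos (ω * s) * p (S s x) i - Real.sin (ω * s) * q (S s x) i)
      (a := 0) (b := t) (by fun_prop) (fun s hs => by
        obtain ⟨h1, h2⟩ := hasDerivWithinAt_coord hS hxy hs.1 i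
        refine (((hlin s).cos.mul h1).sub ((hlin s).sin.mul h2)).congr_deriv ?_
        ring) t (Set.right_mem_Icc.2 ht)
    have e2 := constant_of_has_deriv_right_zero
      (f := fun s => Real.sin (ω * s) * p (S s x) i + Real.cos (ω * s) * q (S s x) i)
      (a := 0) (b := t) (by fun_prop) (fun s hs => by
        obtain ⟨h1, h2⟩ := hasDerivWithinAt_coord hS hxy hs.1 i
        refine (((hlin s).sin.mul h1).add ((hlin s).cos.mul h2)).congr_deriv ?_
        ring) t (Set.right_mem_Icc.2 ht)
    simp only [hS.zero, mul_zero, Real.cos_zero, Real.sin_zero, ContinuousLinearMap.id_apply,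
      one_mul, zero_mul, sub_zero, zero_add] at e1 e2
    have h := Real.sin_sq_add_cos_sq (ω * t)
    constructor
    · linear_combination Real.cos (ω * t) * e1 + Real.sin (ω * t) * e2 - p (S t x) i * h
    · linear_combination Real.cos (ω * t) * e2 - Real.sin (ω * t) * e1 - q (S t x) i * h
  refine ext_pq ?_ ?_ <;> funext i
  · rw [p_flow]; exact (key i).1
  · rw [q_flow]; exact (key i).2

/-- The elements with finitely many coefficients lie in the domain and are dense. -/
theorem WaveAux.exists_mem_graph_tendsto {ι : Type*} {lam : ι → ℝ} [Fact (SupNeg lam)]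
    (x : PhaseSpace lam 0) : ∃ z y : Finset ι → PhaseSpace lam 0,
      (∀ F, (z F, y F) ∈ (waveOp lam).graph) ∧ Tendsto z atTop (𝓝 x) := by
  classical
  have fin : ∀ (F : Finset ι) (a c : ι → ℝ),
      Summable fun i => (if i ∈ F then a i else 0) ^ 2 + (if i ∈ F then c i else 0) ^ 2 :=
    fun F a c => summable_of_ne_finset_zero (s := F) fun i hi => by simp [hi]
  refine ⟨fun F => mkPhase _ _ (fin F (p x) (q x)),
    fun F => mkPhase _ _ (fin F (fun i => freq lam i * q x i) (fun i => -(freq lam i * p x i))),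
    fun F => (mem_graph_iff _ _).2 ⟨fun i => ?_, fun i => ?_⟩, ?_⟩
  · by_cases hi : i ∈ F <;> simp [hi]
  · by_cases hi : i ∈ F <;> simp [hi]
  · rw [← tendsto_sub_nhds_zero_iff]
    refine tendsto_of_coord (summable_pq x) (Eventually.of_forall fun F i => ?_) (fun i => ?_)
      (fun i => ?_)
    · by_cases hi : i ∈ F <;> simp [hi]
      positivity
    · refine tendsto_const_nhds.congr' ?_
      filter_upwards [eventually_ge_atTop {i}] with F hF
      have hi : i ∈ F := hF (Finset.mem_singleton_self i)
      simp [hi]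
    · refine tendsto_const_nhds.congr' ?_
      filter_upwards [eventually_ge_atTop {i}] with F hF
      have hi : i ∈ F := hF (Finset.mem_singleton_self i)
      simp [hi]

theorem waveSemigroup_eq_flow {ι : Type*} (lam : ι → ℝ) [Fact (SupNeg lam)] {t : ℝ} (ht : 0 ≤ t) :
    waveSemigroup lam t = WaveAux.flow t := by
  ext1 x
  obtain ⟨z, y, hzy, hz⟩ := WaveAux.exists_mem_graph_tendsto x
  refine tendsto_nhds_unique (((waveSemigroup lam t).continuous.tendsto x).comp hz) ?_
  refine (((WaveAux.flow t).continuous.tendsto x).comp hz).congr fun F => ?_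
  exact (WaveAux.eq_flow_of_mem_graph (waveSemigroup_spec lam) (hzy F) ht).symm

/-! ### The law of a stochastic integral with deterministic integrand -/

section Wiener

variable {H Ω : Type*} [NormedAddCommGroup H] [InnerProductSpace ℝ H] [mΩ : MeasurableSpace Ω]
  {T : ℝ} {P : Measure Ω} {𝓕 : Filtration (Set.Icc (0 : ℝ) T) mΩ}
  {W : Set.Icc (0 : ℝ) T → H → Ω → ℝ}

theorem IsCylindricalWiener.map_sum (hW : IsCylindricalWiener P 𝓕 W) (t : Set.Icc (0 : ℝ) T)
    {κ : Type*} (s : Finset κ) (c : κ → ℝ) (v : κ → H) :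
    W t (∑ j ∈ s, c j • v j) =ᵐ[P] fun ω => ∑ j ∈ s, c j * W t (v j) ω := by
  classical
  induction s using Finset.induction_on with
  | empty =>
    have h : W t 0 =ᵐ[P] 0 := by simpa using hW.map_smul t 0 0
    simp only [Finset.sum_empty]
    exact h
  | insert j s hj ih =>
    rw [Finset.sum_insert hj]
    filter_upwards [hW.map_add t (c j • v j) (∑ j ∈ s, c j • v j), hW.map_smul t (c j) (v j), ih]
      with ω h1 h2 h3
    rw [h1, Pi.add_apply, h2, h3, Finset.sum_insert hj]
    rfl

/-- Increments over consecutive intervals are independent, so that a sum of them is Gaussian. -/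
theorem IsCylindricalWiener.map_sum_increments [IsProbabilityMeasure P]
    (hW : IsCylindricalWiener P 𝓕 W) {t : ℕ → Set.Icc (0 : ℝ) T} (ht : Monotone t) (z : ℕ → H)
    (n : ℕ) :
    P.map (∑ k ∈ Finset.range n, (W (t (k + 1)) (z k) - W (t k) (z k))) =
      gaussianReal 0 (∑ k ∈ Finset.range n,
        Real.toNNReal (((t (k + 1) : ℝ) - t k) * ‖z k‖ ^ 2)) := by
  induction n with
  | zero =>
    simp only [Finset.range_zero, Finset.sum_empty, gaussianReal_zero_var]
    exact Measure.map_const P (0 : ℝ) |>.trans (by simp)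
  | succ n ih =>
    rw [Finset.sum_range_succ, Finset.sum_range_succ]
    have hS : Measurable[𝓕 (t n)]
        (∑ k ∈ Finset.range n, (W (t (k + 1)) (z k) - W (t k) (z k))) := by
      rw [Finset.sum_fn]
      refine Finset.measurable_sum (M := ℝ) _ fun k hk => ?_
      have hk' : k + 1 ≤ n := Finset.mem_range.1 hk
      exact ((hW.adapted _ _).mono (𝓕.mono (ht hk')) le_rfl).sub
        ((hW.adapted _ _).mono (𝓕.mono (ht (Nat.le_of_succ_le hk'))) le_rfl)
    have hind : IndepFun (∑ k ∈ Finset.range n, (W (t (k + 1)) (z k) - W (t k) (z k)))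
        (W (t (n + 1)) (z n) - W (t n) (z n)) P := by
      rw [IndepFun_iff_Indep]
      exact (indep_of_indep_of_le_right (hW.indep _ _ (ht n.le_succ) (z n)) hS.comap_le).symm
    simpa using gaussianReal_add_gaussianReal_of_indepFun hind ih
      (hW.gaussian _ _ (ht n.le_succ) (z n))

end Wiener

/-- Lebesgue measure on `[0, T]` of a subinterval. -/
theorem comap_subtype_Icc_Ioc {T : ℝ} (a b : Set.Icc (0 : ℝ) T) :
    ((volume : Measure ℝ).comap (Subtype.val : Set.Icc (0 : ℝ) T → ℝ)) (Set.Ioc a b)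
      = ENNReal.ofReal ((b : ℝ) - a) := by
  rw [(MeasurableEmbedding.subtype_coe measurableSet_Icc).comap_apply]
  have : (Subtype.val '' Set.Ioc a b : Set ℝ) = Set.Ioc (a : ℝ) b := by
    ext x
    constructor
    · rintro ⟨y, hy, rfl⟩
      exact hy
    · intro hx
      exact ⟨⟨x, a.2.1.trans hx.1.le, hx.2.trans b.2.2⟩, hx, rfl⟩
  rw [this, Real.volume_Ioc]

instance isFiniteMeasure_comap_subtype_Icc {T : ℝ} :
    IsFiniteMeasure ((volume : Measure ℝ).comap (Subtype.val : Set.Icc (0 : ℝ) T → ℝ)) where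
  measure_univ_lt_top := by
    rw [(MeasurableEmbedding.subtype_coe measurableSet_Icc).comap_apply, Set.image_univ,
      Subtype.range_coe, Real.volume_Icc]
    exact ENNReal.ofReal_lt_top

section Elementary

variable {ι H K Ω : Type*} [NormedAddCommGroup H] [InnerProductSpace ℝ H]
  [NormedAddCommGroup K] [InnerProductSpace ℝ K] [mΩ : MeasurableSpace Ω] {T : ℝ}

namespace ElemIntegrand

/-- The functional `ℓ` composed with the value of an elementary integrand on the `k`-th interval
is the inner product with this vector. -/
def dualVec (E : ElemIntegrand T H K) (ℓ : K →L[ℝ] ℝ) (k : ℕ) : H :=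
  ∑ j ∈ Finset.range E.m, ℓ (E.x k j) • E.v k j

theorem comp_eval (E : ElemIntegrand T H K) (ℓ : K →L[ℝ] ℝ) (s : Set.Icc (0 : ℝ) T) :
    ℓ ∘L E.eval s = ∑ k ∈ Finset.range E.n, (Set.Ioc (E.t k) (E.t (k + 1))).indicator
      (fun _ => innerSL ℝ (E.dualVec ℓ k)) s := by
  ext v
  simp only [eval, ContinuousLinearMap.comp_apply, sum_apply, _root_.map_sum]
  refine Finset.sum_congr rfl fun k _ => ?_
  by_cases hs : s ∈ Set.Ioc (E.t k) (E.t (k + 1))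
  · simp only [hs, Set.indicator_of_mem, dualVec, sum_apply, _root_.map_sum,
      innerSL_apply_apply, ContinuousLinearMap.smulRight_apply, map_smul]
    refine Finset.sum_congr rfl fun j _ => ?_
    simp [mul_comm]
  · simp [hs]

theorem stronglyMeasurable_comp_eval (E : ElemIntegrand T H K) (ℓ : K →L[ℝ] ℝ) :
    StronglyMeasurable fun s => ℓ ∘L E.eval s := by
  simp only [comp_eval]
  refine Finset.stronglyMeasurable_fun_sum _ fun k _ => ?_
  exact stronglyMeasurable_const.indicator measurableSet_Ioc

/-- The intervals of the grid are disjoint. -/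
theorem norm_comp_eval_sq (E : ElemIntegrand T H K) (ℓ : K →L[ℝ] ℝ) (s : Set.Icc (0 : ℝ) T) :
    ‖ℓ ∘L E.eval s‖ ^ 2 = ∑ k ∈ Finset.range E.n, (Set.Ioc (E.t k) (E.t (k + 1))).indicator
      (fun _ => ‖E.dualVec ℓ k‖ ^ 2) s := by
  rw [comp_eval]
  by_cases h : ∃ k ∈ Finset.range E.n, s ∈ Set.Ioc (E.t k) (E.t (k + 1))
  · obtain ⟨k, hk, hs⟩ := h
    have hne : ∀ j, j ≠ k → s ∉ Set.Ioc (E.t j) (E.t (j + 1)) := fun j hj hsj =>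
      Set.disjoint_left.1 (E.mono.pairwise_disjoint_on_Ioc_succ hj) hsj hs
    rw [Finset.sum_eq_single_of_mem k hk fun j _ hj => Set.indicator_of_notMem (hne j hj) _,
      Finset.sum_eq_single_of_mem k hk fun j _ hj => Set.indicator_of_notMem (hne j hj) _,
      Set.indicator_of_mem hs, Set.indicator_of_mem hs, innerSL_apply_norm]
  · push Not at h
    rw [Finset.sum_eq_zero fun k hk => Set.indicator_of_notMem (h k hk) _,
      Finset.sum_eq_zero fun k hk => Set.indicator_of_notMem (h k hk) _]
    simp

theorem integral_norm_comp_eval_sq (E : ElemIntegrand T H K) (ℓ : K →L[ℝ] ℝ) :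
    ∫ s, ‖ℓ ∘L E.eval s‖ ^ 2 ∂((volume : Measure ℝ).comap (↑)) =
      ∑ k ∈ Finset.range E.n, ((E.t (k + 1) : ℝ) - E.t k) * ‖E.dualVec ℓ k‖ ^ 2 := by
  simp only [norm_comp_eval_sq]
  rw [integral_finsetSum _ fun k _ => (integrable_const _).indicator measurableSet_Ioc]
  refine Finset.sum_congr rfl fun k _ => ?_
  rw [integral_indicator_const _ measurableSet_Ioc, measureReal_def, comap_subtype_Icc_Ioc,
    ENNReal.toReal_ofReal (sub_nonneg.2 (E.mono k.le_succ)), smul_eq_mul]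

theorem memLp_comp_eval (E : ElemIntegrand T H K) (ℓ : K →L[ℝ] ℝ) :
    MemLp (fun s => ℓ ∘L E.eval s) 2 ((volume : Measure ℝ).comap (↑)) := by
  refine (memLp_two_iff_integrable_sq_norm
    (E.stronglyMeasurable_comp_eval ℓ).aestronglyMeasurable).2 ?_
  simp only [norm_comp_eval_sq]
  exact integrable_finsetSum _ fun k _ => (integrable_const _).indicator measurableSet_Ioc

variable {P : Measure Ω} {𝓕 : Filtration (Set.Icc (0 : ℝ) T) mΩ}
  {W : Set.Icc (0 : ℝ) T → H → Ω → ℝ}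

theorem dual_integral_ae_eq (E : ElemIntegrand T H K) (hW : IsCylindricalWiener P 𝓕 W)
    (ℓ : K →L[ℝ] ℝ) : (fun ω => ℓ (E.integral W ω)) =ᵐ[P]
      ∑ k ∈ Finset.range E.n, (W (E.t (k + 1)) (E.dualVec ℓ k) - W (E.t k) (E.dualVec ℓ k)) := by
  have h : ∀ k i, W (E.t i) (E.dualVec ℓ k) =ᵐ[P]
      fun ω => ∑ j ∈ Finset.range E.m, ℓ (E.x k j) * W (E.t i) (E.v k j) ω := fun k i =>
    hW.map_sum (E.t i) _ _ _
  filter_upwards [ae_all_iff.2 fun k => ae_all_iff.2 fun i => h k i] with ω hω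
  simp only [integral, _root_.map_sum, map_smul, Finset.sum_apply, Pi.sub_apply, hω, smul_eq_mul]
  refine Finset.sum_congr rfl fun k _ => ?_
  rw [← Finset.sum_sub_distrib]
  exact Finset.sum_congr rfl fun j _ => by ring

/-- The Itô isometry together with Gaussianity, for elementary integrands. -/
theorem map_dual_integral [IsProbabilityMeasure P] (E : ElemIntegrand T H K)
    (hW : IsCylindricalWiener P 𝓕 W) (ℓ : K →L[ℝ] ℝ) :
    P.map (fun ω => ℓ (E.integral W ω)) = gaussianReal 0
      (∫ s, ‖ℓ ∘L E.eval s‖ ^ 2 ∂((volume : Measure ℝ).comap (↑))).toNNReal := by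
  rw [Measure.map_congr (E.dual_integral_ae_eq hW ℓ), hW.map_sum_increments E.mono,
    integral_norm_comp_eval_sq, Real.toNNReal_sum_of_nonneg]
  exact fun k _ => mul_nonneg (sub_nonneg.2 (E.mono k.le_succ)) (sq_nonneg _)

end ElemIntegrand

/-- The operator norm is at most the Hilbert-Schmidt norm: the norm of the functional `ℓ ∘ L` is that
of its Riesz vector, whose coordinates are the `ℓ (L (b i))`. -/
theorem enorm_dual_comp_sq_le [CompleteSpace H] (b : HilbertBasis ι ℝ H) (ℓ : K →L[ℝ] ℝ)
    (L : H →L[ℝ] K) : ‖ℓ ∘L L‖ₑ ^ 2 ≤ ‖ℓ‖ₑ ^ 2 * hsNormSq b L := by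
  set z := (InnerProductSpace.toDual ℝ H).symm (ℓ ∘L L) with hz
  have hzi : ∀ v, inner ℝ z v = ℓ (L v) := fun v =>
    InnerProductSpace.toDual_symm_apply (x := v) (y := ℓ ∘L L)
  have hsum := b.hasSum_inner_mul_inner z z
  have h1 : ‖ℓ ∘L L‖ₑ ^ 2 = ∑' i, ‖ℓ (L (b i))‖ₑ ^ 2 := by
    have e : ∀ i, ‖ℓ (L (b i))‖ₑ ^ 2 = ENNReal.ofReal (inner ℝ z (b i) * inner ℝ (b i) z) :=
      fun i => by
        rw [real_inner_comm z (b i), hzi, ← sq, ← sq_abs, ENNReal.ofReal_pow (abs_nonneg _),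
          ← Real.norm_eq_abs, ofReal_norm]
    have e2 : ‖ℓ ∘L L‖ₑ = ‖z‖ₑ := ((InnerProductSpace.toDual ℝ H).symm.enorm_map _).symm
    rw [tsum_congr e, ← ENNReal.ofReal_tsum_of_nonneg _ hsum.summable, hsum.tsum_eq,
      real_inner_self_eq_norm_sq, ENNReal.ofReal_pow (norm_nonneg _), ofReal_norm, e2]
    intro i
    rw [real_inner_comm z (b i)]
    exact mul_self_nonneg _
  rw [h1, hsNormSq, ← ENNReal.tsum_mul_left]
  refine ENNReal.tsum_le_tsum fun i => ?_
  rw [← mul_pow]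
  gcongr
  exact ℓ.le_opENorm _

theorem tendsto_eLpNorm_two_of_lintegral {α κ F : Type*} [MeasurableSpace α] {μ : Measure α}
    [NormedAddCommGroup F] {f : κ → α → F} {l : Filter κ}
    (h : Tendsto (fun n => ∫⁻ x, ‖f n x‖ₑ ^ 2 ∂μ) l (𝓝 0)) :
    Tendsto (fun n => eLpNorm (f n) 2 μ) l (𝓝 0) := by
  have e : ∀ n, eLpNorm (f n) 2 μ = (∫⁻ x, ‖f n x‖ₑ ^ 2 ∂μ) ^ (1 / 2 : ℝ) := fun n => by
    rw [eLpNorm_eq_lintegral_rpow_enorm_toReal (by norm_num) (by norm_num)]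
    simp
  simp only [e]
  simpa using h.ennrpow_const (1 / 2 : ℝ)

/-- Convergence in `L²` implies convergence of the squared norms. -/
theorem tendsto_integral_norm_sq {α F : Type*} [MeasurableSpace α] {μ : Measure α}
    [NormedAddCommGroup F] {f : ℕ → α → F} {g : α → F} (hf : ∀ n, MemLp (f n) 2 μ)
    (hg : AEStronglyMeasurable g μ)
    (h : Tendsto (fun n => ∫⁻ x, ‖f n x - g x‖ₑ ^ 2 ∂μ) atTop (𝓝 0)) :
    Tendsto (fun n => ∫ x, ‖f n x‖ ^ 2 ∂μ) atTop (𝓝 (∫ x, ‖g x‖ ^ 2 ∂μ)) := by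
  have h2 : Tendsto (fun n => eLpNorm (f n - g) 2 μ) atTop (𝓝 0) :=
    tendsto_eLpNorm_two_of_lintegral h
  -- Square integrability of the limit need not be assumed.
  have hgL : MemLp g 2 μ := by
    obtain ⟨n, hn⟩ := (h2.eventually (gt_mem_nhds ENNReal.zero_lt_top)).exists
    have hd : MemLp (f n - g) 2 μ := ⟨(hf n).1.sub hg, hn⟩
    simpa using (hf n).sub hd
  have e : ∀ {u : α → F} (hu : MemLp u 2 μ), ∫ x, ‖u x‖ ^ 2 ∂μ = ‖hu.toLp u‖ ^ 2 := fun {u} hu => by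
    rw [Lp.norm_toLp, hu.eLpNorm_eq_integral_rpow_norm (by norm_num) (by norm_num)]
    have h0 : 0 ≤ ∫ x, ‖u x‖ ^ 2 ∂μ := integral_nonneg fun x => sq_nonneg _
    simp only [ENNReal.toReal_ofNat, Real.rpow_two]
    rw [ENNReal.toReal_ofReal (by positivity)]
    rw [← Real.rpow_two, ← Real.rpow_mul h0]
    simp
  rw [e hgL]
  simp only [fun n => e (hf n)]
  exact (((Lp.tendsto_Lp_iff_tendsto_eLpNorm'' f hf g hgL).2 h2).norm).pow 2

/-- Gaussianity and the Itô isometry pass to the limit: an `L²` limit of real Gaussian variables is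
Gaussian, by convergence of characteristic functions. -/
theorem IsStochIntegral.map_dual [CompleteSpace H] {b : HilbertBasis ι ℝ H} {P : Measure Ω}
    [IsProbabilityMeasure P] {𝓕 : Filtration (Set.Icc (0 : ℝ) T) mΩ}
    {W : Set.Icc (0 : ℝ) T → H → Ω → ℝ} (hW : IsCylindricalWiener P 𝓕 W)
    {Φ : Set.Icc (0 : ℝ) T → H →L[ℝ] K} {Y : Ω → K} (hY : IsStochIntegral b P W Φ Y)
    (ℓ : K →L[ℝ] ℝ)
    (hΦ : AEStronglyMeasurable (fun s => ℓ ∘L Φ s) ((volume : Measure ℝ).comap (↑))) :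
    P.map (fun ω => ℓ (Y ω)) = gaussianReal 0
      (∫ s, ‖ℓ ∘L Φ s‖ ^ 2 ∂((volume : Measure ℝ).comap (↑))).toNNReal := by
  obtain ⟨-, hYm, E, hE1, hE2⟩ := hY
  have hYm' : AEMeasurable (fun ω => ℓ (Y ω)) P :=
    (ℓ.continuous.comp_aestronglyMeasurable hYm).aemeasurable
  have hEm : ∀ n, AEMeasurable (fun ω => ℓ ((E n).integral W ω)) P := fun n =>
    AEMeasurable.of_map_ne_zero (by
      rw [(E n).map_dual_integral hW]
      exact IsProbabilityMeasure.ne_zero _)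
  have hvar : Tendsto
      (fun n => ∫ s, ‖ℓ ∘L (E n).eval s‖ ^ 2 ∂((volume : Measure ℝ).comap (↑))) atTop
      (𝓝 (∫ s, ‖ℓ ∘L Φ s‖ ^ 2 ∂((volume : Measure ℝ).comap (↑)))) := by
    refine tendsto_integral_norm_sq (fun n => (E n).memLp_comp_eval ℓ) hΦ ?_
    have hlim := ENNReal.Tendsto.const_mul hE1 (Or.inr (show ‖ℓ‖ₑ ^ 2 ≠ ∞ by simp))
    rw [mul_zero] at hlim
    refine tendsto_of_tendsto_of_tendsto_of_le_of_le tendsto_const_nhds hlim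
      (fun _ => zero_le) fun n => ?_
    dsimp only
    rw [← lintegral_const_mul' _ _ (by simp)]
    refine lintegral_mono fun s => ?_
    dsimp only
    rw [← ContinuousLinearMap.comp_sub]
    exact enorm_dual_comp_sq_le b ℓ _
  have hmeas : TendstoInMeasure P (fun n ω => ℓ ((E n).integral W ω)) atTop (fun ω => ℓ (Y ω)) := by
    refine tendstoInMeasure_of_tendsto_eLpNorm (p := 2) (by norm_num)
      (fun n => (hEm n).aestronglyMeasurable) hYm'.aestronglyMeasurable
      (tendsto_eLpNorm_two_of_lintegral ?_)
    have hlim := ENNReal.Tendsto.const_mul hE2 (Or.inr (show ‖ℓ‖ₑ ^ 2 ≠ ∞ by simp))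
    rw [mul_zero] at hlim
    refine tendsto_of_tendsto_of_tendsto_of_le_of_le tendsto_const_nhds hlim
      (fun _ => zero_le) fun n => ?_
    dsimp only
    rw [← lintegral_const_mul' _ _ (by simp)]
    refine lintegral_mono fun ω => ?_
    dsimp only
    rw [Pi.sub_apply, ← _root_.map_sub, ← mul_pow]
    gcongr
    exact ℓ.le_opENorm _
  -- Almost sure convergence along a subsequence is enough to identify the limit law.
  obtain ⟨ns, hns, hae⟩ := hmeas.exists_seq_tendsto_ae
  have := Measure.isProbabilityMeasure_map hYm'
  refine Measure.ext_of_charFun (funext fun θ => ?_)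
  rw [charFun_gaussianReal]
  have hc : ∀ {f : Ω → ℝ}, AEMeasurable f P →
      charFun (P.map f) θ = ∫ ω, Complex.exp (θ * f ω * Complex.I) ∂P := fun hf => by
    rw [charFun_apply_real, integral_map hf (by fun_prop)]
  have h1 : Tendsto (fun k => charFun (P.map fun ω => ℓ ((E (ns k)).integral W ω)) θ) atTop
      (𝓝 (charFun (P.map fun ω => ℓ (Y ω)) θ)) := by
    rw [hc hYm']
    simp only [fun k => hc (hEm (ns k))]
    refine tendsto_integral_of_dominated_convergence (fun _ => 1) (fun k => ?_)
      (integrable_const _) (fun k => ?_) ?_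
    · exact (by fun_prop : Continuous fun y : ℝ => Complex.exp (θ * y * Complex.I))
        |>.comp_aestronglyMeasurable (hEm (ns k)).aestronglyMeasurable
    · refine Eventually.of_forall fun ω => ?_
      rw [← Complex.ofReal_mul, Complex.norm_exp_ofReal_mul_I]
    · filter_upwards [hae] with ω hω
      exact (Complex.continuous_exp.tendsto _).comp
        ((((Complex.continuous_ofReal.tendsto _).comp hω).const_mul _).mul_const _)
  refine tendsto_nhds_unique h1 ?_
  have hvar' := (continuous_real_toNNReal.tendsto _).comp (hvar.comp hns.tendsto_atTop)
  have hvar'' := (NNReal.continuous_coe.tendsto _).comp hvar'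
  simp only [fun n => (E n).map_dual_integral hW, charFun_gaussianReal]
  exact (Complex.continuous_exp.tendsto _).comp (tendsto_const_nhds.sub
    ((((Complex.continuous_ofReal.tendsto _).comp hvar'').mul_const _).div_const _))

end Elementary

/-! ### Families of independent centered Gaussian variables -/

section GaussianFamily

variable {Ω : Type*} [MeasurableSpace Ω] {P : Measure Ω}

/-- If all linear combinations are Gaussian and the variances are those of an uncorrelated family,
then the joint characteristic function factorizes. -/
theorem iIndepFun_of_map_sum_eq_gaussianReal [IsProbabilityMeasure P] {κ : Type*} [Fintype κ]
    {Y : κ → Ω → ℝ}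
    (hYm : ∀ i, Measurable (Y i)) {v : κ → ℝ} (hv : ∀ i, 0 ≤ v i)
    (hY : ∀ θ : κ → ℝ, P.map (fun ω => ∑ i, θ i * Y i ω) =
      gaussianReal 0 (∑ i, θ i ^ 2 * v i).toNNReal) :
    (∀ i, P.map (Y i) = gaussianReal 0 (v i).toNNReal) ∧ iIndepFun Y P := by
  classical
  have h1 : ∀ i, P.map (Y i) = gaussianReal 0 (v i).toNNReal := fun i => by
    simpa [Pi.single_apply] using hY (Pi.single i 1)
  refine ⟨h1, (iIndepFun_iff_charFun_pi fun i => (hYm i).aemeasurable).2 fun t => ?_⟩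
  -- The joint characteristic function at `t` is the one of the combination with coefficients `t`.
  have h2 : charFun (P.map fun ω => WithLp.toLp 2 (Y · ω)) t
      = charFun (P.map fun ω => ∑ i, t i * Y i ω) 1 := by
    rw [charFun_apply, charFun_apply_real, integral_map (by fun_prop) (by fun_prop),
      integral_map (by fun_prop) (by fun_prop)]
    simp [PiLp.inner_apply, mul_comm]
  rw [h2, hY, charFun_gaussianReal]
  simp only [h1, charFun_gaussianReal]
  rw [← Complex.exp_sum, Real.coe_toNNReal _ (Finset.sum_nonneg fun i _ =>
    mul_nonneg (sq_nonneg _) (hv i))]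
  simp only [Real.coe_toNNReal _ (hv _)]
  congr 1
  push_cast
  simp only [mul_zero, zero_mul, zero_sub, one_pow, mul_one, Finset.sum_neg_distrib,
    Finset.sum_div]
  congr 1
  exact Finset.sum_congr rfl fun i _ => by ring

theorem integral_exp_neg_sum_sq [IsProbabilityMeasure P] {κ : Type*} [Fintype κ] {Y : κ → Ω → ℝ}
    (hYm : ∀ i, Measurable (Y i)) {v : κ → ℝ} (hv : ∀ i, 0 ≤ v i)
    (hY : ∀ θ : κ → ℝ, P.map (fun ω => ∑ i, θ i * Y i ω) =
      gaussianReal 0 (∑ i, θ i ^ 2 * v i).toNNReal) :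
    ∫ ω, Real.exp (-∑ i, Y i ω ^ 2) ∂P = ∏ i, (√(1 + 2 * v i))⁻¹ := by
  obtain ⟨h1, h2⟩ := iIndepFun_of_map_sum_eq_gaussianReal hYm hv hY
  simp only [← Finset.sum_neg_distrib, Real.exp_sum]
  rw [h2.integral_fun_prod_comp (f := fun _ x => Real.exp (-x ^ 2))
    (fun i => (hYm i).aemeasurable) (fun i => by fun_prop)]
  refine Finset.prod_congr rfl fun i _ => ?_
  rw [← integral_map (f := fun x => Real.exp (-x ^ 2)) (hYm i).aemeasurable (by fun_prop), h1,
    integral_exp_neg_sq_gaussianReal, Real.coe_toNNReal _ (hv i)]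

theorem lintegral_sq_of_map_eq_gaussianReal {Y : Ω → ℝ} (hYm : Measurable Y) {v : ℝ≥0}
    (hY : P.map Y = gaussianReal 0 v) : ∫⁻ ω, ENNReal.ofReal (Y ω ^ 2) ∂P = v := by
  have hint : Integrable (fun x : ℝ => x ^ 2) (gaussianReal 0 v) :=
    (memLp_id_gaussianReal 2).integrable_sq
  have hvar : ∫ x, x ^ 2 ∂(gaussianReal 0 v) = v := by
    have h := variance_id_gaussianReal (μ := 0) (v := v)
    rw [variance_eq_integral aemeasurable_id] at h
    simpa [integral_id_gaussianReal] using h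
  rw [← lintegral_map (f := fun x => ENNReal.ofReal (x ^ 2)) (by fun_prop) hYm, hY,
    ← ofReal_integral_eq_lintegral_ofReal hint (Eventually.of_forall fun x => sq_nonneg x), hvar,
    ENNReal.ofReal_coe_nnreal]

variable {ι : Type*} [Countable ι] {Y : ι → Ω → ℝ} {v : ι → ℝ}

theorem integrable_tsum_sq (hYm : ∀ i, Measurable (Y i)) (hv : ∀ i, 0 ≤ v i) (hvs : Summable v)
    (hYs : ∀ ω, Summable fun i => Y i ω ^ 2)
    (hY : ∀ i, P.map (Y i) = gaussianReal 0 (v i).toNNReal) :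
    Integrable (fun ω => ∑' i, Y i ω ^ 2) P ∧ ∫ ω, ∑' i, Y i ω ^ 2 ∂P = ∑' i, v i := by
  have hm : Measurable fun ω => ∑' i, Y i ω ^ 2 :=
    Measurable.tsum fun i => (hYm i).pow_const 2
  have h0 : ∀ ω, 0 ≤ ∑' i, Y i ω ^ 2 := fun ω => tsum_nonneg fun i => sq_nonneg _
  have hl : ∫⁻ ω, ENNReal.ofReal (∑' i, Y i ω ^ 2) ∂P = ENNReal.ofReal (∑' i, v i) := by
    rw [ENNReal.ofReal_tsum_of_nonneg hv hvs]
    simp only [fun ω => ENNReal.ofReal_tsum_of_nonneg (fun i => sq_nonneg (Y i ω)) (hYs ω)]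
    rw [lintegral_tsum fun i => by have := hYm i; fun_prop]
    exact tsum_congr fun i => lintegral_sq_of_map_eq_gaussianReal (hYm i) (hY i)
  refine ⟨⟨hm.aestronglyMeasurable, ?_⟩, ?_⟩
  · rw [hasFiniteIntegral_iff_ofReal (Eventually.of_forall h0), hl]
    exact ENNReal.ofReal_lt_top
  · rw [integral_eq_lintegral_of_nonneg_ae (Eventually.of_forall h0) hm.aestronglyMeasurable, hl,
      ENNReal.toReal_ofReal (tsum_nonneg hv)]

theorem tendsto_prod_integral_exp_neg_tsum_sq [IsProbabilityMeasure P]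
    (hYm : ∀ i, Measurable (Y i)) (hv : ∀ i, 0 ≤ v i)
    (hYs : ∀ ω, Summable fun i => Y i ω ^ 2)
    (hY : ∀ (F : Finset ι) (θ : F → ℝ), P.map (fun ω => ∑ i, θ i * Y i ω) =
      gaussianReal 0 (∑ i, θ i ^ 2 * v i).toNNReal) :
    Tendsto (fun F : Finset ι => ∏ i ∈ F, (√(1 + 2 * v i))⁻¹) atTop
      (𝓝 (∫ ω, Real.exp (-∑' i, Y i ω ^ 2) ∂P)) := by
  have h : ∀ F : Finset ι, ∫ ω, Real.exp (-∑ i ∈ F, Y i ω ^ 2) ∂P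
      = ∏ i ∈ F, (√(1 + 2 * v i))⁻¹ := fun F => by
    have h := integral_exp_neg_sum_sq (Y := fun i : F => Y i) (fun i => hYm i) (fun i => hv i)
      (hY F)
    rw [← Finset.prod_coe_sort, ← h]
    exact integral_congr_ae (Eventually.of_forall fun ω => by
      dsimp only
      rw [← Finset.sum_coe_sort])
  simp only [← h]
  refine tendsto_integral_filter_of_dominated_convergence (fun _ => 1)
    (Eventually.of_forall fun F => ?_) (Eventually.of_forall fun F => ?_) (integrable_const _) ?_
  · exact Measurable.aestronglyMeasurable (by fun_prop)
  · refine Eventually.of_forall fun ω => ?_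
    rw [Real.norm_of_nonneg (Real.exp_pos _).le, Real.exp_le_one_iff]
    exact neg_nonpos.2 (Finset.sum_nonneg fun i _ => sq_nonneg _)
  · exact Eventually.of_forall fun ω =>
      (Real.continuous_exp.tendsto _).comp (Tendsto.neg (hYs ω).hasSum)

end GaussianFamily

/-! ### The coordinates of the stochastic convolution -/

theorem HilbertBasis.countable_of_separable {ι H : Type*} [NormedAddCommGroup H]
    [InnerProductSpace ℝ H] [TopologicalSpace.SeparableSpace H] (b : HilbertBasis ι ℝ H) :
    Countable ι := by
  have hd : ∀ i j, i ≠ j → 1 ≤ dist (b i) (b j) := fun i j hij => by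
    rw [dist_eq_norm, ← sq_le_sq₀ zero_le_one (norm_nonneg _), @norm_sub_sq_real,
      b.orthonormal.1 i, b.orthonormal.1 j, b.orthonormal.2 hij]
    norm_num
  have h : (Set.univ : Set ι).PairwiseDisjoint fun i => Metric.ball (b i) (1 / 2) :=
    fun i _ j _ hij => Metric.ball_disjoint_ball (by linarith [hd i j hij])
  exact Set.countable_univ_iff.1 (h.countable_of_isOpen (fun i _ => Metric.isOpen_ball)
    fun i _ => ⟨b i, Metric.mem_ball_self (by norm_num)⟩)

namespace WaveAux

variable {ι H Ω : Type*} (lam : ι → ℝ)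

/-- The response at time `t` of the `j`-th component in the mode `h` to a unit impulse. -/
noncomputable def response (mu : ι → ℝ) (j : Fin 2) (h : ι) (t : ℝ) : ℝ :=
  ![Real.sin (freq lam h * t), Real.cos (freq lam h * t)] j * ((freq lam h)⁻¹ * mu h)

theorem continuous_response (mu : ι → ℝ) (j : Fin 2) (h : ι) :
    Continuous (response lam mu j h) := by
  unfold response
  fin_cases j <;> simp <;> fun_prop

/-- The variance at time `T` of the `j`-th component in the mode `h`. -/
noncomputable def coordVar (T : ℝ) (mu : ι → ℝ) (j : Fin 2) (h : ι) : ℝ :=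
  ∫ s : Set.Icc (0 : ℝ) T, response lam mu j h (T - s) ^ 2 ∂((volume : Measure ℝ).comap (↑))

theorem coordVar_nonneg (T : ℝ) (mu : ι → ℝ) (j : Fin 2) (h : ι) : 0 ≤ coordVar lam T mu j h :=
  integral_nonneg fun _ => sq_nonneg _

variable [Fact (SupNeg lam)]

/-- The normalized coordinate at `h` of the first (`j = 0`) or second (`j = 1`) component, as a
continuous functional. -/
noncomputable def coord (j : Fin 2) (h : ι) : PhaseSpace lam 0 →L[ℝ] ℝ :=
  LinearMap.mkContinuous (![LinearMap.proj h ∘ₗ p, LinearMap.proj h ∘ₗ q] j) 1 fun x => by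
    rw [one_mul]
    fin_cases j
    · exact abs_p_le x h
    · exact abs_q_le x h

theorem coord_zero (h : ι) (x : PhaseSpace lam 0) : coord lam 0 h x = p x h := rfl

theorem coord_one (h : ι) (x : PhaseSpace lam 0) : coord lam 1 h x = q x h := rfl

theorem summable_coord_sq (j : Fin 2) (x : PhaseSpace lam 0) :
    Summable fun h => coord lam j h x ^ 2 := by
  fin_cases j
  · exact summable_p x
  · exact summable_q x

theorem compNormSq_eq_tsum (j : Fin 2) (x : PhaseSpace lam 0) :
    compNormSq lam j x = ∑' h, coord lam j h x ^ 2 := by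
  fin_cases j
  · refine (InterpSpace.norm_sq_eq_tsum x.fst).trans (tsum_congr fun i => ?_)
    simp [coord_zero, p]
  · refine (InterpSpace.norm_sq_eq_tsum x.snd).trans (tsum_congr fun i => ?_)
    rw [rpow_neg_half]; rfl

theorem response_sq_le (mu : ι → ℝ) (j : Fin 2) (h : ι) (t : ℝ) :
    response lam mu j h t ^ 2 ≤ mu h ^ 2 / |lam h| := by
  have hf : ((freq lam h)⁻¹ * mu h) ^ 2 = mu h ^ 2 / |lam h| := by
    have e : freq lam h ^ 2 = |lam h| := by
      rw [sq, freq_sq, abs_of_neg (Fact.out (p := SupNeg lam)).neg]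
    rw [mul_pow, inv_pow, e, div_eq_inv_mul]
  rw [response, mul_pow, hf]
  refine mul_le_of_le_one_left (by positivity) ?_
  fin_cases j
  · exact Real.sin_sq_le_one _
  · exact Real.cos_sq_le_one _

variable [NormedAddCommGroup H] [InnerProductSpace ℝ H]

/-- The integrand of the stochastic convolution maps a vector to the response of each mode in `I` to
the corresponding coefficient of the vector. -/
theorem coord_integrand (b : HilbertBasis ι ℝ H) (mu : ι → ℝ)
    (hmu : Summable fun h => mu h ^ 2 / |lam h|) (I : Set ι) {t : ℝ} (ht : 0 ≤ t) (j : Fin 2)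
    (h : ι) (v : H) :
    coord lam j h ((waveSemigroup lam t ∘L phaseProj lam 0 I ∘L noiseOp b lam mu hmu) v)
      = I.indicator (fun h => response lam mu j h t) h * inner ℝ (b h) v := by
  rw [waveSemigroup_eq_flow lam ht]
  set x := phaseProj lam 0 I (noiseOp b lam mu hmu v)
  have hp : p x h = 0 := by
    change I.indicator (InterpSpace.coeff (0 : InterpSpace lam (0 / 2))) h = 0
    simp
  have hq : q x h = (freq lam h)⁻¹ * I.indicator (fun i => mu i * inner ℝ (b i) v) h := rfl
  change coord lam j h (flow t x) = _
  fin_cases j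
  · by_cases hI : h ∈ I <;> simp [coord_zero, p_flow, hp, hq, response, hI]
    ring
  · by_cases hI : h ∈ I <;> simp [coord_one, q_flow, hp, hq, response, hI]
    ring

theorem integrable_response_sq (T : ℝ) (mu : ι → ℝ) (j : Fin 2) (h : ι) :
    Integrable (fun s : Set.Icc (0 : ℝ) T => response lam mu j h (T - s) ^ 2)
      ((volume : Measure ℝ).comap (↑)) := by
  have hc : Continuous fun s : Set.Icc (0 : ℝ) T => response lam mu j h (T - s) ^ 2 :=
    ((continuous_response lam mu j h).comp (by fun_prop)).pow 2
  refine Integrable.of_bound hc.aestronglyMeasurable (mu h ^ 2 / |lam h|)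
    (Eventually.of_forall fun s => ?_)
  rw [Real.norm_of_nonneg (sq_nonneg _)]
  exact response_sq_le lam mu j h _

theorem summable_coordVar (T : ℝ) {mu : ι → ℝ} (hmu : Summable fun h => mu h ^ 2 / |lam h|)
    (j : Fin 2) : Summable (coordVar lam T mu j) := by
  refine Summable.of_nonneg_of_le (coordVar_nonneg lam T mu j) (fun h => ?_)
    (hmu.mul_left (((volume : Measure ℝ).comap
      (Subtype.val : Set.Icc (0 : ℝ) T → ℝ)).real Set.univ))
  refine (integral_mono (integrable_response_sq lam T mu j h) (integrable_const _)
    fun s => response_sq_le lam mu j h _).trans_eq ?_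
  rw [integral_const, smul_eq_mul]

/-- Linear combinations of the coordinates of the stochastic convolution are Gaussian, and distinct
coordinates are uncorrelated, because each mode is driven by its own component of the noise. -/
theorem map_sum_coord [CompleteSpace H] [mΩ : MeasurableSpace Ω] {T : ℝ} {P : Measure Ω}
    [IsProbabilityMeasure P] {𝓕 : Filtration (Set.Icc (0 : ℝ) T) mΩ}
    {W : Set.Icc (0 : ℝ) T → H → Ω → ℝ} (hW : IsCylindricalWiener P 𝓕 W)
    {b : HilbertBasis ι ℝ H} {mu : ι → ℝ} {hmu : Summable fun h => mu h ^ 2 / |lam h|}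
    {I : Set ι} {X : Ω → PhaseSpace lam 0}
    (hX : IsStochIntegral b P W
      (fun s => waveSemigroup lam (T - s) ∘L phaseProj lam 0 I ∘L noiseOp b lam mu hmu) X)
    (j : Fin 2) (F : Finset ι) (θ : F → ℝ) :
    P.map (fun ω => ∑ h, θ h * coord lam j h (X ω)) = gaussianReal 0
      (∑ h, θ h ^ 2 * I.indicator (coordVar lam T mu j) h).toNNReal := by
  set ℓ : PhaseSpace lam 0 →L[ℝ] ℝ := ∑ h, θ h • coord lam j h with hℓ
  have hℓx : ∀ x, ℓ x = ∑ h, θ h * coord lam j h x := fun x => by simp [hℓ]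
  have hΦ : ∀ s : Set.Icc (0 : ℝ) T,
      ℓ ∘L (waveSemigroup lam (T - s) ∘L phaseProj lam 0 I ∘L noiseOp b lam mu hmu) =
      innerSL ℝ (∑ h : F, (θ h * I.indicator (fun h => response lam mu j h (T - s)) h) • b h) :=
    fun s => by
      ext v
      rw [ContinuousLinearMap.comp_apply, hℓx, innerSL_apply_apply, sum_inner]
      refine Finset.sum_congr rfl fun h _ => ?_
      rw [coord_integrand lam b mu hmu I (sub_nonneg.2 s.2.2), real_inner_smul_left, mul_assoc]
  have hind : ∀ (h : ι) (g : ι → ℝ), I.indicator g h = I.indicator 1 h * g h := fun h g => by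
    by_cases hI : h ∈ I <;> simp [hI]
  have hcont : Continuous fun s : Set.Icc (0 : ℝ) T =>
      ℓ ∘L (waveSemigroup lam (T - s) ∘L phaseProj lam 0 I ∘L noiseOp b lam mu hmu) := by
    simp only [hΦ]
    refine (innerSL ℝ).continuous.comp (continuous_finsetSum _ fun h _ => ?_)
    simp only [fun s => hind h (fun h => response lam mu j h s)]
    have := continuous_response lam mu j h
    fun_prop
  have hnorm : ∀ s : Set.Icc (0 : ℝ) T,
      ‖ℓ ∘L (waveSemigroup lam (T - s) ∘L phaseProj lam 0 I ∘L noiseOp b lam mu hmu)‖ ^ 2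
      = ∑ h : F, θ h ^ 2 * (I.indicator 1 (h : ι) * response lam mu j h (T - s) ^ 2) := fun s => by
    rw [hΦ, innerSL_apply_norm, ← real_inner_self_eq_norm_sq]
    refine ((b.orthonormal.comp _ Subtype.val_injective).inner_sum _ _ _).trans ?_
    refine Finset.sum_congr rfl fun h _ => ?_
    by_cases hI : (h : ι) ∈ I <;> simp [hI]
    ring
  have hmap := hX.map_dual hW ℓ hcont.aestronglyMeasurable
  simp only [hℓx] at hmap
  rw [hmap]
  simp only [hnorm]
  congr 2
  rw [integral_finsetSum _ fun (h : F) _ =>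
    ((integrable_response_sq lam T mu j h).const_mul _).const_mul _]
  refine Finset.sum_congr rfl fun h _ => ?_
  rw [integral_const_mul, integral_const_mul, hind h (coordVar lam T mu j)]
  rfl

end WaveAux

/-! ### The weak error estimate -/

theorem proposition2p8 {ι H Ω : Type*} [Nonempty ι]
    [NormedAddCommGroup H] [InnerProductSpace ℝ H] [CompleteSpace H]
    [TopologicalSpace.SeparableSpace H]
    (T : ℝ) (hT : 0 < T)
    [mΩ : MeasurableSpace Ω] (P : Measure Ω) [IsProbabilityMeasure P]
    (𝓕 : Filtration (Set.Icc (0 : ℝ) T) mΩ) (h𝓕 : IsNormalFiltration P 𝓕)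
    (W : Set.Icc (0 : ℝ) T → H → Ω → ℝ) (hW : IsCylindricalWiener P 𝓕 W)
    (b : HilbertBasis ι ℝ H)
    (lam : ι → ℝ) [Fact (SupNeg lam)]
    (mu : ι → ℝ) (hmu : Summable fun h => mu h ^ 2 / |lam h|)
    (X : Set ι → Ω → PhaseSpace lam 0)
    (hXm : ∀ I, StronglyMeasurable (X I))
    (hXr : ∀ I ω, X I ω ∈ Set.range (phaseProj lam 0 I))
    (hX : ∀ I, IsStochIntegral b P W
      (fun s => waveSemigroup lam (T - s) ∘L phaseProj lam 0 I ∘L noiseOp b lam mu hmu) (X I)) :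
    ∀ i : Fin 2, IsCbTwo (testFun lam i) ∧
      ∀ I : Set ι,
        Integrable (fun ω => testFun lam i (X I ω)) P ∧
        Integrable (fun ω => compNormSq lam i (X I ω)) P ∧
        (∫ ω, testFun lam i (X I ω) ∂P) - (∫ ω, testFun lam i (X Set.univ ω) ∂P) ≥
          ((∫ ω, compNormSq lam i (X Set.univ ω) ∂P) - ∫ ω, compNormSq lam i (X I ω) ∂P) /
            Real.exp (6 * ∫ ω, compNormSq lam i (X Set.univ ω) ∂P) := by
  intro j
  have : Countable ι := b.countable_of_separable
  set a : ι → ℝ := WaveAux.coordVar lam T mu j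
  have ha : ∀ h, 0 ≤ a h := WaveAux.coordVar_nonneg lam T mu j
  have has : Summable a := WaveAux.summable_coordVar lam T hmu j
  have hind0 : ∀ (I : Set ι) h, 0 ≤ I.indicator a h := fun I =>
    Set.indicator_nonneg fun h _ => ha h
  have hXc : ∀ I h, Measurable fun ω => WaveAux.coord lam j h (X I ω) := fun I h =>
    ((WaveAux.coord lam j h).continuous.comp_stronglyMeasurable (hXm I)).measurable
  have hXs : ∀ I ω, Summable fun h => WaveAux.coord lam j h (X I ω) ^ 2 := fun I ω =>
    WaveAux.summable_coord_sq lam j _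
  have hlaw := fun I => WaveAux.map_sum_coord lam hW (hX I) j
  have hlaw1 : ∀ I h, P.map (fun ω => WaveAux.coord lam j h (X I ω)) =
      gaussianReal 0 (I.indicator a h).toNNReal := fun I h => by
    simpa using hlaw I {h} 1
  have hN : ∀ I, Integrable (fun ω => compNormSq lam j (X I ω)) P ∧
      ∫ ω, compNormSq lam j (X I ω) ∂P = ∑' h, I.indicator a h := fun I => by
    simp only [WaveAux.compNormSq_eq_tsum]
    exact integrable_tsum_sq (hXc I) (hind0 I) (has.indicator I) (hXs I) (hlaw1 I)
  have hE : ∀ I, Tendsto (fun F : Finset ι => ∏ h ∈ F, (√(1 + 2 * I.indicator a h))⁻¹) atTop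
      (𝓝 (∫ ω, testFun lam j (X I ω) ∂P)) := fun I => by
    simp only [testFun, WaveAux.compNormSq_eq_tsum]
    exact tendsto_prod_integral_exp_neg_tsum_sq (hXc I) (hind0 I) (hXs I) (hlaw I)
  refine ⟨isCbTwo_testFun lam j, fun I => ⟨?_, (hN I).1, ?_⟩⟩
  · obtain ⟨hsmooth, C, hC⟩ := isCbTwo_testFun lam j
    exact Integrable.of_bound
      (hsmooth.continuous.comp_stronglyMeasurable (hXm I)).aestronglyMeasurable C
      (Eventually.of_forall fun ω => (hC _).1)
  · have hS : ∀ I : Set ι, Tendsto (fun F : Finset ι => ∑ h ∈ F, I.indicator a h) atTop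
        (𝓝 (∑' h, I.indicator a h)) := fun I => (has.indicator I).hasSum
    have hSu := hS Set.univ
    have hEu := hE Set.univ
    rw [(hN I).2, (hN Set.univ).2, ge_iff_le]
    simp only [Set.indicator_univ] at hSu hEu ⊢
    refine le_of_tendsto_of_tendsto
      ((hSu.sub (hS I)).div ((Real.continuous_exp.tendsto _).comp (hSu.const_mul 6))
        (Real.exp_pos _).ne') ((hE I).sub hEu)
      (Eventually.of_forall fun F => sum_div_exp_le_prod_sub_prod F I ha)
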